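/- Let $I\subseteq\mathbb R$ be an open interval, $f:I\to\mathbb R$ smooth with $f'\not\equiv 0$, and consider the generalized quasilinear KdV equation $$G:=u_t+\bigl(u(uu_x)_x+f(u)\bigr)_x=0 .$$ A local conservation law is a pair $(T,X)$ of smooth functions of $t,x,u$ and finitely many derivatives of $u$ (defined on a box of jets: each of $t$, $x$, $u\in I$ and each derivative $\partial_x^j u$ ranges over a given nonempty open interval, and the derivatives involving $t$ are unrestricted) such that $D_tT+D_xX=0$ on the solution space (the jets on which $G$ and all its total derivatives vanish). It is low-order if it has a multiplier $Q(t,x,u,u_x,u_{xx})$, i.e. if there are $\tilde T,\tilde X$ equal to $T,X$ on the solution space with $D_t\tilde T+D_x\tilde X=G\,Q$ identically. Two conservation laws are equivalent if on the solution space their densities differ by $D_x\Theta$ and their fluxes by $-D_t\Theta$, for some smooth function $\Theta$ of $t,x,u$ and finitely many derivatives of $u$. (i) For every such $f$ the following are low-order local conservation laws: $$T_1=u,\qquad X_1=u^2u_{xx}+uu_x^2+f(u);$$ $$T_2=\tfrac12u^2,\qquad X_2=u^3u_{xx}+\tfrac12u^2u_x^2+\int uf'(u)\,du;$$ $$T_3=\tfrac12u^2u_x^2-\int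 f(u)\,du,$$ $$X_3=-\tfrac12u^4u_{xx}^2-u^3u_x^2u_{xx}-\tfrac12u^2u_x^4-u^2u_tu_x-f(u)u^2u_{xx}-f(u)uu_x^2-\tfrac12f(u)^2 .$$ If $f$ is not of the form $f_0u^5+f_1u+f_2$ on $I$ (with constants $f_0,f_1,f_2$), every low-order local conservation law is equivalent to exactly one linear combination, with constant coefficients, of these three. (ii) There is an additional low-order local conservation law (one not equivalent to a linear combination of the three above) if and only if $f(u)=f_0u^5+f_1u+f_2$ on $I$ with constants $f_0,f_1,f_2$, $(f_0,f_1)\neq(0,0)$. In this case $$T_4=\tfrac13f_0tu^6-tu^2u_x^2+\tfrac15(f_1t-x)u^2,$$ $$\begin{aligned}X_4={}&2f_0tu^7u_{xx}+tu^4u_{xx}^2+2tu^3u_x^2u_{xx}+\tfrac25f_1tu^3u_{xx}-\tfrac25xu^3u_{xx}+\tfrac25u^3u_x+tu^2u_x^4-\tfrac15xu^2u_x^2\\&+2tu^2u_tu_x+2f_0tu^6u_x^2+\tfrac65f_1tu^2u_x^2+f_0^2tu^{10}+\tfrac23f_0f_1tu^6-\tfrac13f_0xu^6+\tfrac15f_1^2tu^2-\tfrac15f_1xu^2\end{aligned}$$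 is a low-order local conservation law, and every low-order local conservation law is equivalent to exactly one linear combination, with constant coefficients, of $(T_1,X_1),\dots,(T_4,X_4)$. -/

import Mathlib

open scoped ContDiff

/-- The coordinates of the jet space of scalar functions `u(t, x)`: the independent variables `t`
and `x`, and for all `i j` the coordinate `u i j`, which stands for `∂ₜ^i ∂ₓ^j u`. -/
inductive JetVar : Type
  | t : JetVar
  | x : JetVar
  | u (i j : ℕ) : JetVar
  deriving DecidableEq

/-- A point of the (infinite) jet space. -/
abbrev Jet : Type := JetVar → ℝ

noncomputable section

namespace QKdV

/-- The box of all jets whose coordinate `c` lies in `R c`. -/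
def jetBox (R : JetVar → Set ℝ) : Set Jet := {z | ∀ c, z c ∈ R c}

/-- Admissible boxes: every coordinate ranges over a nonempty open interval (bounded or not), and
the coordinates that contain a `t`-derivative are unrestricted. -/
def IsJetBox (R : JetVar → Set ℝ) : Prop :=
  (∀ c, IsOpen (R c) ∧ (R c).OrdConnected ∧ (R c).Nonempty) ∧
    ∀ i j, R (JetVar.u (i + 1) j) = Set.univ

/-- `F` is, on the box, a smooth function of the finitely many coordinates in `S`. -/
def IsDiffFunOf (R : JetVar → Set ℝ) (S : Finset JetVar) (F : Jet → ℝ) : Prop :=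
  ∃ g : (S → ℝ) → ℝ,
    ContDiffOn ℝ ∞ g {y | ∀ c : S, y c ∈ R c} ∧ ∀ z ∈ jetBox R, F z = g fun c => z c

/-- Differential functions on the box: smooth functions of `t`, `x`, `u` and finitely many
derivatives of `u`. -/
def IsDiffFun (R : JetVar → Set ℝ) (F : Jet → ℝ) : Prop :=
  ∃ S : Finset JetVar, IsDiffFunOf R S F

/-- The partial derivative of `F` with respect to the jet coordinate `c`. -/
def pd (c : JetVar) (F : Jet → ℝ) (z : Jet) : ℝ :=
  deriv (fun s : ℝ => F (Function.update z c s)) (z c)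

/-- The total derivative `D_t = ∂_t + ∑ u_{i+1,j} ∂_{u_{i,j}}`; for a differential function only
finitely many terms are nonzero. -/
def Dt (F : Jet → ℝ) (z : Jet) : ℝ :=
  pd JetVar.t F z +
    ∑ᶠ p : ℕ × ℕ, z (JetVar.u (p.1 + 1) p.2) * pd (JetVar.u p.1 p.2) F z

/-- The total derivative `D_x = ∂_x + ∑ u_{i,j+1} ∂_{u_{i,j}}`. -/
def Dx (F : Jet → ℝ) (z : Jet) : ℝ :=
  pd JetVar.x F z +
    ∑ᶠ p : ℕ × ℕ, z (JetVar.u p.1 (p.2 + 1)) * pd (JetVar.u p.1 p.2) F z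

/-! The coordinate functions `t`, `x`, `u`, `u_t`, `u_x`, `u_xx`. -/

abbrev ct (z : Jet) : ℝ := z JetVar.t
abbrev cx (z : Jet) : ℝ := z JetVar.x
abbrev cu (z : Jet) : ℝ := z (JetVar.u 0 0)
abbrev cut (z : Jet) : ℝ := z (JetVar.u 1 0)
abbrev cux (z : Jet) : ℝ := z (JetVar.u 0 1)
abbrev cuxx (z : Jet) : ℝ := z (JetVar.u 0 2)

/-- The left-hand side of the generalized quasilinear KdV equation
`u_t + (u (u u_x)_x + f(u))_x = 0`. -/
def pde (f : ℝ → ℝ) (z : Jet) : ℝ :=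
  cut z + Dx (fun w => cu w * Dx (fun v => cu v * cux v) w + f (cu w)) z

/-- The solution space: the jets in the box that satisfy the equation and all its total
derivatives. -/
def solSpace (R : JetVar → Set ℝ) (f : ℝ → ℝ) : Set Jet :=
  {z | z ∈ jetBox R ∧ ∀ i j : ℕ, (Dt^[i] (Dx^[j] (pde f))) z = 0}

/-- Pairs `(T, X)` of a density and a flux. -/
abbrev Pair : Type := (Jet → ℝ) × (Jet → ℝ)

/-- `(T, X)` is a local conservation law: `D_t T + D_x X = 0` on the solution space. -/
def IsConsLaw (R : JetVar → Set ℝ) (f : ℝ → ℝ) (L : Pair) : Prop :=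
  IsDiffFun R L.1 ∧ IsDiffFun R L.2 ∧ ∀ z ∈ solSpace R f, Dt L.1 z + Dx L.2 z = 0

/-- `Q` is a multiplier of `(T, X)`: without changing `T` and `X` on the solution space, the
conservation law can be put in the characteristic form `D_t T + D_x X = (equation) * Q`, which
holds off the solution space. -/
def HasMultiplier (R : JetVar → Set ℝ) (f : ℝ → ℝ) (L : Pair) (Q : Jet → ℝ) : Prop :=
  ∃ L' : Pair, IsDiffFun R L'.1 ∧ IsDiffFun R L'.2 ∧
    (∀ z ∈ solSpace R f, L'.1 z = L.1 z ∧ L'.2 z = L.2 z) ∧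
    ∀ z ∈ jetBox R, Dt L'.1 z + Dx L'.2 z = pde f z * Q z

/-- Low-order local conservation laws: those with a multiplier `Q(t, x, u, u_x, u_xx)`. -/
def IsLowOrderLaw (R : JetVar → Set ℝ) (f : ℝ → ℝ) (L : Pair) : Prop :=
  IsConsLaw R f L ∧ ∃ Q : Jet → ℝ,
    IsDiffFunOf R {JetVar.t, JetVar.x, JetVar.u 0 0, JetVar.u 0 1, JetVar.u 0 2} Q ∧
      HasMultiplier R f L Q

/-- Equivalence of conservation laws: they differ by a trivial one, that is, on the solution space
the densities differ by `D_x Θ` and the fluxes by `-D_t Θ`. -/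
def EquivLaw (R : JetVar → Set ℝ) (f : ℝ → ℝ) (L L' : Pair) : Prop :=
  ∃ Θ : Jet → ℝ, IsDiffFun R Θ ∧
    ∀ z ∈ solSpace R f, L.1 z - L'.1 z = Dx Θ z ∧ L.2 z - L'.2 z = -Dt Θ z

/-- Conservation of mass. -/
def massLaw (f : ℝ → ℝ) : Pair :=
  (fun z => cu z,
   fun z => cu z ^ 2 * cuxx z + cu z * cux z ^ 2 + f (cu z))

/-- Conservation of momentum; `H` is an antiderivative of `u f'(u)`. -/
def momentumLaw (H : ℝ → ℝ) : Pair :=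
  (fun z => 1 / 2 * cu z ^ 2,
   fun z => cu z ^ 3 * cuxx z + 1 / 2 * cu z ^ 2 * cux z ^ 2 + H (cu z))

/-- Conservation of energy; `F` is an antiderivative of `f`. -/
def energyLaw (f F : ℝ → ℝ) : Pair :=
  (fun z => 1 / 2 * cu z ^ 2 * cux z ^ 2 - F (cu z),
   fun z => -(1 / 2) * cu z ^ 4 * cuxx z ^ 2 - cu z ^ 3 * cux z ^ 2 * cuxx z
     - 1 / 2 * cu z ^ 2 * cux z ^ 4 - cu z ^ 2 * cut z * cux z
     - f (cu z) * cu z ^ 2 * cuxx z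
     - f (cu z) * cu z * cux z ^ 2 - 1 / 2 * f (cu z) ^ 2)

/-- The additional conservation law for `f(u) = f₀ u⁵ + f₁ u + f₂`. -/
def extraLaw (f₀ f₁ : ℝ) : Pair :=
  (fun z => 1 / 3 * f₀ * ct z * cu z ^ 6 - ct z * cu z ^ 2 * cux z ^ 2
     + 1 / 5 * (f₁ * ct z - cx z) * cu z ^ 2,
   fun z => 2 * f₀ * ct z * cu z ^ 7 * cuxx z + ct z * cu z ^ 4 * cuxx z ^ 2
     + 2 * ct z * cu z ^ 3 * cux z ^ 2 * cuxx z + 2 / 5 * f₁ * ct z * cu z ^ 3 * cuxx z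
     - 2 / 5 * cx z * cu z ^ 3 * cuxx z + 2 / 5 * cu z ^ 3 * cux z
     + ct z * cu z ^ 2 * cux z ^ 4 - 1 / 5 * cx z * cu z ^ 2 * cux z ^ 2
     + 2 * ct z * cu z ^ 2 * cut z * cux z + 2 * f₀ * ct z * cu z ^ 6 * cux z ^ 2
     + 6 / 5 * f₁ * ct z * cu z ^ 2 * cux z ^ 2 + f₀ ^ 2 * ct z * cu z ^ 10
     + 2 / 3 * f₀ * f₁ * ct z * cu z ^ 6 - 1 / 3 * f₀ * cx z * cu z ^ 6
     + 1 / 5 * f₁ ^ 2 * ct z * cu z ^ 2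
     - 1 / 5 * f₁ * cx z * cu z ^ 2)

/-- `f(u) = f₀ u⁵ + f₁ u + f₂` on the interval `I`. -/
def IsSpecial (I : Set ℝ) (f : ℝ → ℝ) (f₀ f₁ f₂ : ℝ) : Prop :=
  ∀ v ∈ I, f v = f₀ * v ^ 5 + f₁ * v + f₂

end QKdV

end

/-! ### Differentiation under the integral sign -/

noncomputable section
open Set Filter Topology MeasureTheory Interval

/-! Conservation laws up to equivalence are replaced by their multipliers, and the multipliers are
found from an overdetermined linear system.

For each `i` let `E_i` be the Euler operator in `∂ₜ^i u` and its `x`-derivatives. It kills `D_x`,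
and `E_{i+1} D_t = D_t E_{i+1} + E_i`, `E_0 D_t = D_t E_0`. In `G Q` the only `t`-derivative is the
`u_t` multiplying `Q`, so descending in `i` from `D_t T + D_x X = G Q` gives `E_i T = 0` for `i ≥
1`, then `E_0 T = Q`, and finally the determining equation `D_t Q = E_0 (G Q)`
(`euler_eq_multiplier`). If `Q = 0`, all `E_i T` vanish, and a homotopy-free order reduction shows
that the law is trivial (`exists_potential`). Hence equal multipliers give equivalent laws.
Conversely, the solution space contains a graph over the `x`-jets, on which `D_t` becomes an
evolutionary derivation. Pulling back along this graph turns an equivalence between laws with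
spatial densities into an identity on the whole box, and applying `E_0` shows that the multipliers
agree (`HasSpatialForm.eq_of_equivLaw`).

Write `M = u²u_xx + u u_x² + f(u)` for the mass flux. For `Q(t, x, u, u_x, u_xx)` the determining
equation forces `Q_{u_x} = D_x Q_{u_xx}` and `u D_x Q_{u_xx} = 2 u_x Q_{u_xx}`, so `Q = c(t) M +
k(t, x, u)`. As `M` satisfies the determining equation itself (`-M` is the multiplier of the
energy), what remains for `k` is `k_uu = 0`, `k_x = u k_xu`, `c' = -5 k_xu = γ` constant, and `5γ f
+ 5 k_t = γ u f'` (`base_solution`). If `γ = 0`, then `Q` is a combination of `1`, `u`, `M`. If `γ ≠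
0`, the last equation makes `f` a combination of `u⁵`, `u`, `1` (`special_of_equation`). For such
`f` the extra multiplier has `γ = 2`, and subtracting a multiple of it leads back to `γ = 0`.

Since `u` may vanish on `I`, nothing is ever divided by `u`. Factors `u` are cancelled because a
continuous function that vanishes off `u = 0` vanishes everywhere. The computations take place in
the ring `DF R` of differential functions on the box, where total derivatives are derivations. -/

/-- Smoothness of integrals depending on a parameter, over a fixed compact interval. -/
theorem contDiffOn_integral_param {E : Type} [NormedAddCommGroup E] [NormedSpace ℝ E]
    [FiniteDimensional ℝ E] {U : Set E} (hU : IsOpen U) {W : Set (E × ℝ)} (hW : IsOpen W)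
    (hUW : ∀ y ∈ U, ∀ s ∈ Icc (0 : ℝ) 1, (y, s) ∈ W) (n : ℕ) :
    ∀ {F : Type} [NormedAddCommGroup F] [NormedSpace ℝ F] [CompleteSpace F] {h : E × ℝ → F},
      ContDiffOn ℝ ∞ h W → ContDiffOn ℝ n (fun y => ∫ s in (0 : ℝ)..1, h (y, s)) U := by
  have key : ∀ {F : Type} [NormedAddCommGroup F] [NormedSpace ℝ F] [CompleteSpace F]
      {h : E × ℝ → F}, ContDiffOn ℝ ∞ h W → ∀ y₀ ∈ U,
      HasFDerivAt (fun y => ∫ s in (0 : ℝ)..1, h (y, s))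
        (∫ s in (0 : ℝ)..1, (fderiv ℝ h (y₀, s)).comp (ContinuousLinearMap.inl ℝ E ℝ)) y₀ := by
    intro F _ _ _ h hh y₀ hy₀
    have : ProperSpace E := FiniteDimensional.proper ℝ E
    have hcont' : ContinuousOn
        (fun p => (fderiv ℝ h p).comp (ContinuousLinearMap.inl ℝ E ℝ)) W :=
      ((hh.continuousOn_fderiv_of_isOpen hW (by simp)).clm_comp continuousOn_const)
    obtain ⟨r, hr, hball⟩ := Metric.isOpen_iff.1 hU y₀ hy₀
    have hclosed : Metric.closedBall y₀ (r / 2) ⊆ U :=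
      (Metric.closedBall_subset_ball (by linarith)).trans hball
    have hK : IsCompact (Metric.closedBall y₀ (r / 2) ×ˢ Icc (0 : ℝ) 1) :=
      (isCompact_closedBall _ _).prod isCompact_Icc
    have hKW : Metric.closedBall y₀ (r / 2) ×ˢ Icc (0 : ℝ) 1 ⊆ W :=
      fun p hp => hUW p.1 (hclosed hp.1) p.2 hp.2
    -- Compactness of the closed ball times `[0, 1]` supplies the dominating constant.
    obtain ⟨C, hC⟩ := hK.exists_bound_of_continuousOn (hcont'.mono hKW)
    have hIoc : ∀ {t : ℝ}, t ∈ Ι (0 : ℝ) 1 → t ∈ Icc (0 : ℝ) 1 := by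
      intro t ht
      rw [uIoc_of_le zero_le_one] at ht
      exact Ioc_subset_Icc_self ht
    have hslice : ∀ y ∈ U, ContinuousOn (fun s : ℝ => (y, s)) (Icc 0 1) :=
      fun y _ => by fun_prop
    have hI : ∀ y ∈ U, ContinuousOn (fun s => h (y, s)) (Icc 0 1) := fun y hy =>
      hh.continuousOn.comp (hslice y hy) (fun s hs => hUW y hy s hs)
    have hI' : ∀ y ∈ U, ContinuousOn
        (fun s => (fderiv ℝ h (y, s)).comp (ContinuousLinearMap.inl ℝ E ℝ)) (Icc 0 1) :=
      fun y hy => hcont'.comp (hslice y hy) (fun s hs => hUW y hy s hs)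
    have hii : ∀ {F : Type} [NormedAddCommGroup F] {φ : ℝ → F}, ContinuousOn φ (Icc 0 1) →
        IntervalIntegrable φ volume 0 1 := fun hφ =>
      ContinuousOn.intervalIntegrable (by rwa [uIcc_of_le zero_le_one])
    refine intervalIntegral.hasFDerivAt_integral_of_dominated_of_fderiv_le
      (s := Metric.ball y₀ (r / 2)) (bound := fun _ => C)
      (F' := fun y s => (fderiv ℝ h (y, s)).comp (ContinuousLinearMap.inl ℝ E ℝ))
      (Metric.ball_mem_nhds _ (by linarith)) ?_ (hii (hI y₀ hy₀)) ?_ ?_ (by simp) ?_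
    · filter_upwards [hU.mem_nhds hy₀] with y hy
      exact (intervalIntegrable_iff.1 (hii (hI y hy))).aestronglyMeasurable
    · exact (intervalIntegrable_iff.1 (hii (hI' y₀ hy₀))).aestronglyMeasurable
    · refine Eventually.of_forall fun t ht y hy => ?_
      exact hC (y, t) ⟨Metric.ball_subset_closedBall hy, hIoc ht⟩
    · refine Eventually.of_forall fun t ht y hy => ?_
      have hyU := hclosed (Metric.ball_subset_closedBall hy)
      have hd : HasFDerivAt h (fderiv ℝ h (y, t)) (y, t) :=
        ((hh.contDiffAt (hW.mem_nhds (hUW y hyU t (hIoc ht)))).differentiableAt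
          (by simp)).hasFDerivAt
      exact hd.comp y (hasFDerivAt_prodMk_left y t)
  -- The derivative in `y` is again such an integral, with values in `E →L[ℝ] F`. The induction
  -- therefore has to run over all target spaces at once.
  induction n with
  | zero =>
    intro F _ _ _ h hh
    exact contDiffOn_zero.2 fun y hy => (key hh y hy).continuousAt.continuousWithinAt
  | succ n ih =>
    intro F _ _ _ h hh
    push_cast
    rw [contDiffOn_succ_iff_fderiv_of_isOpen hU]
    refine ⟨fun y hy => (key hh y hy).differentiableAt.differentiableWithinAt, by simp, ?_⟩
    have h1 : ContDiffOn ℝ ∞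
        (fun p => (fderiv ℝ h p).comp (ContinuousLinearMap.inl ℝ E ℝ)) W :=
      (hh.fderiv_of_isOpen hW (by simp)).clm_comp contDiffOn_const
    exact (ih h1).congr fun y hy => (key hh y hy).fderiv

end

/-! ### Calculus of functions of finitely many jet coordinates -/

noncomputable section
open Set Filter Topology MeasureTheory Interval
namespace QKdV

variable {R : JetVar → Set ℝ}

/-- The domain of the smooth functions of the coordinates in `S`. -/
def boxOn (R : JetVar → Set ℝ) (S : Finset JetVar) : Set (S → ℝ) := {y | ∀ c : S, y c ∈ R c}

theorem boxOn_eq_pi (S : Finset JetVar) : boxOn R S = Set.pi univ fun c : S => R c := by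
  ext y; simp [boxOn]

theorem isOpen_boxOn (hR : IsJetBox R) (S : Finset JetVar) : IsOpen (boxOn R S) := by
  rw [boxOn_eq_pi]
  exact isOpen_set_pi finite_univ fun c _ => (hR.1 c).1

theorem convex_boxOn (hR : IsJetBox R) (S : Finset JetVar) : Convex ℝ (boxOn R S) := by
  rw [boxOn_eq_pi]
  exact convex_pi fun c _ => (hR.1 c).2.1.convex

theorem restrict_mem_boxOn {z : Jet} (hz : z ∈ jetBox R) (S : Finset JetVar) :
    (fun c : S => z c) ∈ boxOn R S := fun c => hz c

theorem update_mem_jetBox {z : Jet} (hz : z ∈ jetBox R) {c : JetVar} {s : ℝ} (hs : s ∈ R c) :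
    Function.update z c s ∈ jetBox R := by
  intro d
  by_cases h : d = c
  · subst h; simpa using hs
  · simpa [Function.update_of_ne h] using hz d

theorem jetBox_nonempty (hR : IsJetBox R) : (jetBox R).Nonempty := by
  choose z hz using fun c => (hR.1 c).2.2
  exact ⟨z, hz⟩

/-- A jet of the box with prescribed coordinates in `S`. -/
theorem exists_extension (hR : IsJetBox R) {S : Finset JetVar} {y : S → ℝ} (hy : y ∈ boxOn R S) :
    ∃ z ∈ jetBox R, (fun c : S => z c) = y := by
  obtain ⟨z, hz⟩ := jetBox_nonempty hR
  refine ⟨fun c => if h : c ∈ S then y ⟨c, h⟩ else z c, fun c => ?_, ?_⟩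
  · by_cases h : c ∈ S
    · simpa [h] using hy ⟨c, h⟩
    · simpa [h] using hz c
  · funext c; simp

namespace IsDiffFunOf

theorem mono {S S' : Finset JetVar} (h : S ⊆ S') {F : Jet → ℝ} (hF : IsDiffFunOf R S F) :
    IsDiffFunOf R S' F := by
  obtain ⟨g, hg, hFg⟩ := hF
  refine ⟨fun y => g fun c => y ⟨c, h c.2⟩, ?_, fun z hz => hFg z hz⟩
  exact hg.comp (ContDiff.contDiffOn (by fun_prop)) fun y hy c => hy ⟨c, h c.2⟩

theorem congr {S : Finset JetVar} {F F' : Jet → ℝ} (hF : IsDiffFunOf R S F)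
    (h : ∀ z ∈ jetBox R, F' z = F z) : IsDiffFunOf R S F' := by
  obtain ⟨g, hg, hFg⟩ := hF
  exact ⟨g, hg, fun z hz => (h z hz).trans (hFg z hz)⟩

theorem const (S : Finset JetVar) (r : ℝ) : IsDiffFunOf R S fun _ => r :=
  ⟨fun _ => r, contDiffOn_const, fun _ _ => rfl⟩

theorem coord {S : Finset JetVar} {c : JetVar} (hc : c ∈ S) : IsDiffFunOf R S fun z => z c :=
  ⟨fun y => y ⟨c, hc⟩, ContDiff.contDiffOn (by fun_prop), fun _ _ => rfl⟩

theorem add {S : Finset JetVar} {F F' : Jet → ℝ} (hF : IsDiffFunOf R S F)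
    (hF' : IsDiffFunOf R S F') : IsDiffFunOf R S fun z => F z + F' z := by
  obtain ⟨g, hg, h⟩ := hF
  obtain ⟨g', hg', h'⟩ := hF'
  exact ⟨fun y => g y + g' y, hg.add hg', fun z hz => by simp only [h z hz, h' z hz]⟩

theorem mul {S : Finset JetVar} {F F' : Jet → ℝ} (hF : IsDiffFunOf R S F)
    (hF' : IsDiffFunOf R S F') : IsDiffFunOf R S fun z => F z * F' z := by
  obtain ⟨g, hg, h⟩ := hF
  obtain ⟨g', hg', h'⟩ := hF'
  exact ⟨fun y => g y * g' y, hg.mul hg', fun z hz => by simp only [h z hz, h' z hz]⟩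

theorem neg {S : Finset JetVar} {F : Jet → ℝ} (hF : IsDiffFunOf R S F) :
    IsDiffFunOf R S fun z => -F z := by
  simpa using (const S (-1)).mul hF

theorem sub {S : Finset JetVar} {F F' : Jet → ℝ} (hF : IsDiffFunOf R S F)
    (hF' : IsDiffFunOf R S F') : IsDiffFunOf R S fun z => F z - F' z := by
  simpa [sub_eq_add_neg] using hF.add hF'.neg

theorem pow {S : Finset JetVar} {F : Jet → ℝ} (hF : IsDiffFunOf R S F) (n : ℕ) :
    IsDiffFunOf R S fun z => F z ^ n := by
  induction n with
  | zero => simpa using const S 1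
  | succ n ih => simpa [pow_succ] using ih.mul hF

theorem comp_coord {S : Finset JetVar} {c : JetVar} (hc : c ∈ S) {φ : ℝ → ℝ}
    (hφ : ContDiffOn ℝ ∞ φ (R c)) : IsDiffFunOf R S fun z => φ (z c) :=
  ⟨fun y => φ (y ⟨c, hc⟩), hφ.comp (ContDiff.contDiffOn (by fun_prop)) fun _ hy => hy ⟨c, hc⟩,
    fun _ _ => rfl⟩

/-- Substitution of differential functions for the coordinates. -/
theorem comp (hR : IsJetBox R) {S S' : Finset JetVar} {F : Jet → ℝ} (hF : IsDiffFunOf R S F) {σ : Jet → Jet}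
    (hσ : ∀ z ∈ jetBox R, σ z ∈ jetBox R) (hσS : ∀ c ∈ S, IsDiffFunOf R S' fun z => σ z c) :
    IsDiffFunOf R S' fun z => F (σ z) := by
  obtain ⟨g, hg, h⟩ := hF
  choose! G hG hGσ using hσS
  refine ⟨fun y => g fun c => G c y, hg.comp (contDiffOn_pi.2 fun c => hG c c.2) ?_, ?_⟩
  · intro y hy c
    obtain ⟨z, hz, rfl⟩ := exists_extension hR hy
    simpa only [← hGσ c c.2 z hz] using hσ z hz c
  · intro z hz
    refine (h _ (hσ z hz)).trans (congrArg g ?_)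
    funext c
    exact hGσ c c.2 z hz

end IsDiffFunOf


theorem hasFDerivAt_rep (hR : IsJetBox R) {S : Finset JetVar} {g : (S → ℝ) → ℝ}
    (hg : ContDiffOn ℝ ∞ g (boxOn R S)) {y : S → ℝ} (hy : y ∈ boxOn R S) :
    HasFDerivAt g (fderiv ℝ g y) y :=
  ((hg.contDiffAt ((isOpen_boxOn hR S).mem_nhds hy)).differentiableAt (by simp)).hasFDerivAt

theorem hasDerivAt_comp_rep (hR : IsJetBox R) {S : Finset JetVar} {g : (S → ℝ) → ℝ}
    (hg : ContDiffOn ℝ ∞ g (boxOn R S)) {F : Jet → ℝ}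
    (hF : ∀ z ∈ jetBox R, F z = g fun c => z c) {γ : ℝ → Jet} {s₀ : ℝ}
    (hγ : ∀ᶠ s in 𝓝 s₀, γ s ∈ jetBox R) {v : S → ℝ}
    (hv : ∀ c : S, HasDerivAt (fun s => γ s c) (v c) s₀) :
    HasDerivAt (fun s => F (γ s)) (fderiv ℝ g (fun c : S => γ s₀ c) v) s₀ := by
  have h1 : HasDerivAt (fun s => fun c : S => γ s c) v s₀ := hasDerivAt_pi.2 hv
  have h2 := (hasFDerivAt_rep hR hg (restrict_mem_boxOn hγ.self_of_nhds S)).comp_hasDerivAt s₀ h1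
  refine h2.congr_of_eventuallyEq ?_
  filter_upwards [hγ] with s hs using hF _ hs

theorem eventually_update_mem (hR : IsJetBox R) {z : Jet} (hz : z ∈ jetBox R) (c : JetVar) :
    ∀ᶠ s in 𝓝 (z c), Function.update z c s ∈ jetBox R := by
  filter_upwards [(hR.1 c).1.mem_nhds (hz c)] with s hs using update_mem_jetBox hz hs

theorem hasDerivAt_update_rep (hR : IsJetBox R) {S : Finset JetVar} {g : (S → ℝ) → ℝ}
    (hg : ContDiffOn ℝ ∞ g (boxOn R S)) {F : Jet → ℝ}
    (hF : ∀ z ∈ jetBox R, F z = g fun c => z c) {z : Jet} (hz : z ∈ jetBox R) (c : JetVar) :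
    HasDerivAt (fun s => F (Function.update z c s))
      (fderiv ℝ g (fun d : S => z d) fun d => if (d : JetVar) = c then 1 else 0) (z c) := by
  have := hasDerivAt_comp_rep hR hg hF (γ := fun s => Function.update z c s) (s₀ := z c)
    (eventually_update_mem hR hz c) (v := fun d => if (d : JetVar) = c then 1 else 0) ?_
  · simpa using this
  · intro d
    by_cases h : (d : JetVar) = c
    · subst h
      simpa using hasDerivAt_id' (z d)
    · simpa [h, Function.update_of_ne h] using hasDerivAt_const (z c) (z d)

theorem pd_rep (hR : IsJetBox R) {S : Finset JetVar} {g : (S → ℝ) → ℝ}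
    (hg : ContDiffOn ℝ ∞ g (boxOn R S)) {F : Jet → ℝ}
    (hF : ∀ z ∈ jetBox R, F z = g fun c => z c) {z : Jet} (hz : z ∈ jetBox R) (c : JetVar) :
    pd c F z = fderiv ℝ g (fun d : S => z d) fun d => if (d : JetVar) = c then 1 else 0 :=
  (hasDerivAt_update_rep hR hg hF hz c).deriv

namespace IsDiffFunOf

theorem hasDerivAt_update (hR : IsJetBox R) {S : Finset JetVar} {F : Jet → ℝ}
    (hF : IsDiffFunOf R S F) {z : Jet} (hz : z ∈ jetBox R) (c : JetVar) :
    HasDerivAt (fun s => F (Function.update z c s)) (pd c F z) (z c) := by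
  obtain ⟨g, hg, h⟩ := hF
  exact (hasDerivAt_update_rep hR hg h hz c).differentiableAt.hasDerivAt

theorem hasDerivAt_update' (hR : IsJetBox R) {S : Finset JetVar} {F : Jet → ℝ}
    (hF : IsDiffFunOf R S F) {z : Jet} (hz : z ∈ jetBox R) {c : JetVar} {r : ℝ} (hr : r ∈ R c) :
    HasDerivAt (fun s => F (Function.update z c s)) (pd c F (Function.update z c r)) r := by
  simpa using hF.hasDerivAt_update hR (update_mem_jetBox hz hr) c

theorem pd (hR : IsJetBox R) {S : Finset JetVar} {F : Jet → ℝ} (hF : IsDiffFunOf R S F)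
    (c : JetVar) : IsDiffFunOf R S (pd c F) := by
  obtain ⟨g, hg, h⟩ := hF
  exact ⟨_, (hg.fderiv_of_isOpen (isOpen_boxOn hR S) (by simp)).clm_apply contDiffOn_const,
    fun z hz => pd_rep hR hg h hz c⟩

theorem pd_eq_zero {S : Finset JetVar} {F : Jet → ℝ} (hR : IsJetBox R) (hF : IsDiffFunOf R S F)
    {c : JetVar} (hc : c ∉ S) {z : Jet} (hz : z ∈ jetBox R) : QKdV.pd c F z = 0 := by
  obtain ⟨g, hg, h⟩ := hF
  rw [pd_rep hR hg h hz c]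
  have : (fun d : S => if (d : JetVar) = c then (1 : ℝ) else 0) = 0 := by
    funext d
    have : (d : JetVar) ≠ c := fun h => hc (h ▸ d.2)
    simp [this]
  rw [this, map_zero]

/-- The chain rule along a curve in the box. -/
theorem hasDerivAt_comp (hR : IsJetBox R) {S : Finset JetVar} {F : Jet → ℝ}
    (hF : IsDiffFunOf R S F) {γ : ℝ → Jet} {s₀ : ℝ}
    (hγ : ∀ᶠ s in 𝓝 s₀, γ s ∈ jetBox R) {v : JetVar → ℝ}
    (hv : ∀ c ∈ S, HasDerivAt (fun s => γ s c) (v c) s₀) :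
    HasDerivAt (fun s => F (γ s)) (∑ c ∈ S, v c * QKdV.pd c F (γ s₀)) s₀ := by
  obtain ⟨g, hg, h⟩ := hF
  have h1 := hasDerivAt_comp_rep hR hg h hγ (v := fun c => v c) fun c => hv c c.2
  convert h1 using 1
  have h2 : (fun c : S => v c) =
      ∑ c : S, v c • (fun d : S => if (d : JetVar) = c then (1 : ℝ) else 0) := by
    funext d
    simp [Finset.sum_apply]
  rw [h2, map_sum, ← Finset.sum_coe_sort S]
  refine Finset.sum_congr rfl fun c _ => ?_
  rw [pd_rep hR hg h hγ.self_of_nhds, map_smul, smul_eq_mul]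

theorem pd_comm (hR : IsJetBox R) {S : Finset JetVar} {F : Jet → ℝ}
    (hF : IsDiffFunOf R S F) (c d : JetVar) {z : Jet} (hz : z ∈ jetBox R) :
    QKdV.pd c (QKdV.pd d F) z = QKdV.pd d (QKdV.pd c F) z := by
  obtain ⟨g, hg, h⟩ := hF
  have hy := restrict_mem_boxOn hz S
  have hn := (isOpen_boxOn hR S).mem_nhds hy
  have hg' := hg.fderiv_of_isOpen (m := ∞) (isOpen_boxOn hR S) (by simp)
  have key : ∀ c d : JetVar, QKdV.pd c (QKdV.pd d F) z =
      fderiv ℝ (fderiv ℝ g) (fun d : S => z d) (fun d => if (d : JetVar) = c then 1 else 0)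
        (fun e => if (e : JetVar) = d then 1 else 0) := by
    intro c d
    rw [pd_rep hR (hg'.clm_apply contDiffOn_const) (fun z hz => pd_rep hR hg h hz d) hz c]
    have h1 : HasFDerivAt (fderiv ℝ g) _ _ :=
      ((hg'.contDiffAt hn).differentiableAt (by simp)).hasFDerivAt
    have h2 := h1.clm_apply (hasFDerivAt_const
      (fun e : S => if (e : JetVar) = d then (1 : ℝ) else 0) (fun d : S => z d))
    rw [h2.fderiv]
    simp
  rw [key, key]
  exact (hg.contDiffAt hn).isSymmSndFDerivAt 
    (by simpa using (by exact_mod_cast le_top : ((2 : ℕ∞) : WithTop ℕ∞) ≤ ∞)) _ _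

/-- A differential function without partial derivatives is constant. -/
theorem eq_of_pd_eq_zero (hR : IsJetBox R) {S : Finset JetVar} {F : Jet → ℝ}
    (hF : IsDiffFunOf R S F) (h0 : ∀ c, ∀ z ∈ jetBox R, QKdV.pd c F z = 0) {z z' : Jet}
    (hz : z ∈ jetBox R) (hz' : z' ∈ jetBox R) : F z = F z' := by
  obtain ⟨g, hg, h⟩ := hF
  rw [h z hz, h z' hz']
  refine (isOpen_boxOn hR S).is_const_of_fderiv_eq_zero (convex_boxOn hR S).isPreconnected
    (fun y hy => (hasFDerivAt_rep hR hg hy).differentiableAt.differentiableWithinAt) ?_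
    (restrict_mem_boxOn hz S) (restrict_mem_boxOn hz' S)
  intro y hy
  obtain ⟨w, hw, rfl⟩ := exists_extension hR hy
  ext v
  have h2 : v = ∑ c : S, v c • (fun d : S => if (d : JetVar) = c then (1 : ℝ) else 0) := by
    funext d
    simp [Finset.sum_apply]
  rw [h2, map_sum]
  refine Finset.sum_eq_zero fun c _ => ?_
  rw [map_smul, ← pd_rep hR hg h hw c, h0 c w hw, smul_zero]

/-- A differential function without derivative in direction `c` does not depend on `c`. -/
theorem update_eq (hR : IsJetBox R) {S : Finset JetVar} {F : Jet → ℝ}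
    (hF : IsDiffFunOf R S F) {c : JetVar} (h0 : ∀ z ∈ jetBox R, QKdV.pd c F z = 0) {z : Jet}
    (hz : z ∈ jetBox R) {r : ℝ} (hr : r ∈ R c) : F (Function.update z c r) = F z := by
  have h1 : F (Function.update z c r) = F (Function.update z c (z c)) := by
    refine (hR.1 c).1.is_const_of_deriv_eq_zero (f := fun s => F (Function.update z c s))
      (hR.1 c).2.1.isPreconnected ?_ ?_ hr (hz c)
    · intro s hs
      exact (hF.hasDerivAt_update' hR hz hs).differentiableAt.differentiableWithinAt
    · intro s hs
      simpa [h0 _ (update_mem_jetBox hz hs)] using (hF.hasDerivAt_update' hR hz hs).deriv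
  simpa using h1

theorem pd_comp (hR : IsJetBox R) {S : Finset JetVar} {F : Jet → ℝ} (hF : IsDiffFunOf R S F)
    {σ : Jet → Jet} (hσ : ∀ z ∈ jetBox R, σ z ∈ jetBox R) {S' : Finset JetVar}
    (hσS : ∀ c ∈ S, IsDiffFunOf R S' fun z => σ z c) (d : JetVar) {z : Jet} (hz : z ∈ jetBox R) :
    QKdV.pd d (fun w => F (σ w)) z =
      ∑ c ∈ S, QKdV.pd d (fun w => σ w c) z * QKdV.pd c F (σ z) := by
  have h := hF.hasDerivAt_comp hR (γ := fun s => σ (Function.update z d s)) (s₀ := z d)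
    (v := fun c => QKdV.pd d (fun w => σ w c) z)
    ((eventually_update_mem hR hz d).mono fun s hs => hσ _ hs)
    fun c hc => (hσS c hc).hasDerivAt_update hR hz d
  have h' := h.deriv
  rw [Function.update_eq_self] at h'
  exact h'

end IsDiffFunOf

/-- The primitive of `F` in the coordinate `c` that vanishes where this coordinate is `b`. -/
def primitive (c : JetVar) (b : ℝ) (F : Jet → ℝ) (z : Jet) : ℝ :=
  ∫ r in b..z c, F (Function.update z c r)

/-- The substitution `r = b + (z c - b) s` moves the variable endpoint into the integrand, so that
smoothness follows from `contDiffOn_integral_param`. -/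
theorem primitive_eq (c : JetVar) (b : ℝ) (F : Jet → ℝ) (z : Jet) :
    primitive c b F z =
      (z c - b) * ∫ s in (0 : ℝ)..1, F (Function.update z c (b + (z c - b) * s)) := by
  have := intervalIntegral.smul_integral_comp_add_mul (a := 0) (b := 1)
    (fun r => F (Function.update z c r)) (z c - b) b
  simp only [smul_eq_mul, mul_zero, add_zero, mul_one, add_sub_cancel] at this
  exact this.symm

theorem segment_mem (hR : IsJetBox R) {c : JetVar} {b r : ℝ} (hb : b ∈ R c) (hr : r ∈ R c) {s : ℝ}
    (hs : s ∈ Icc (0 : ℝ) 1) : b + (r - b) * s ∈ R c := by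
  have := (hR.1 c).2.1.convex.add_smul_sub_mem hb hr hs
  simpa [mul_comm] using this

namespace IsDiffFunOf

theorem primitive (hR : IsJetBox R) {S : Finset JetVar} {F : Jet → ℝ} (hF : IsDiffFunOf R S F)
    {c : JetVar} (hc : c ∈ S) {b : ℝ} (hb : b ∈ R c) :
    IsDiffFunOf R S (QKdV.primitive c b F) := by
  suffices h : IsDiffFunOf R S
      fun z => ∫ s in (0 : ℝ)..1, F (Function.update z c (b + (z c - b) * s)) from
    (((coord hc).sub (const S b)).mul h).congr fun z _ => primitive_eq c b F z
  obtain ⟨g, hg, h⟩ := hF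
  let A : (S → ℝ) × ℝ → (S → ℝ) := fun p d =>
    if (d : JetVar) = c then b + (p.1 ⟨c, hc⟩ - b) * p.2 else p.1 d
  have hA : ContDiff ℝ ∞ A := by
    refine contDiff_pi.2 fun d => ?_
    by_cases hd : (d : JetVar) = c
    · simp only [A, hd, if_true]; fun_prop
    · simp only [A, hd, if_false]; fun_prop
  have hAm : ∀ y ∈ boxOn R S, ∀ s ∈ Icc (0 : ℝ) 1, A (y, s) ∈ boxOn R S := by
    intro y hy s hs d
    by_cases hd : (d : JetVar) = c
    · simp only [A, hd, if_true]
      exact segment_mem hR hb (hy ⟨c, hc⟩) hs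
    · simpa only [A, hd, if_false] using hy d
  -- The integrand is smooth on this open set, which contains the box times `[0, 1]` because the
  -- coordinate ranges are convex.
  have hW : IsOpen (A ⁻¹' boxOn R S) := (isOpen_boxOn hR S).preimage hA.continuous
  refine ⟨fun y => ∫ s in (0 : ℝ)..1, g (A (y, s)), ?_, ?_⟩
  · refine contDiffOn_infty.2 fun n => ?_
    exact contDiffOn_integral_param (isOpen_boxOn hR S) hW (fun y hy s hs => hAm y hy s hs) n
      (h := fun p => g (A p)) (hg.comp hA.contDiffOn fun p hp => hp)
  · intro z hz
    refine intervalIntegral.integral_congr fun s hs => ?_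
    rw [uIcc_of_le zero_le_one] at hs
    refine (h _ (update_mem_jetBox hz (segment_mem hR hb (hz c) hs))).trans (congrArg g ?_)
    funext d
    by_cases hd : (d : JetVar) = c
    · simp [A, hd]
    · simp [A, hd]

theorem pd_primitive_self (hR : IsJetBox R) {S : Finset JetVar} {F : Jet → ℝ}
    (hF : IsDiffFunOf R S F) {c : JetVar} {b : ℝ} (hb : b ∈ R c) {z : Jet} (hz : z ∈ jetBox R) :
    QKdV.pd c (QKdV.primitive c b F) z = F z := by
  have hcont : ContinuousOn (fun r => F (Function.update z c r)) (R c) := fun r hr =>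
    (hF.hasDerivAt_update' hR hz hr).continuousAt.continuousWithinAt
  have hsub : uIcc b (z c) ⊆ R c := (hR.1 c).2.1.uIcc_subset hb (hz c)
  have h := intervalIntegral.integral_hasDerivAt_right
    (hcont.mono hsub).intervalIntegrable
    (hcont.stronglyMeasurableAtFilter (hR.1 c).1 (z c) (hz c))
    (hcont.continuousAt ((hR.1 c).1.mem_nhds (hz c)))
  simpa [QKdV.pd, QKdV.primitive] using h.deriv

theorem pd_primitive_of_ne (hR : IsJetBox R) {S : Finset JetVar} {F : Jet → ℝ}
    (hF : IsDiffFunOf R S F) {c d : JetVar} (hcd : d ≠ c) {b : ℝ} (hb : b ∈ R c)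
    (h0 : ∀ z ∈ jetBox R, QKdV.pd d F z = 0) {z : Jet} (hz : z ∈ jetBox R) :
    QKdV.pd d (QKdV.primitive c b F) z = 0 := by
  have h : (fun s => QKdV.primitive c b F (Function.update z d s)) =ᶠ[𝓝 (z d)]
      fun _ => QKdV.primitive c b F z := by
    filter_upwards [(hR.1 d).1.mem_nhds (hz d)] with s hs
    simp only [QKdV.primitive, Function.update_of_ne hcd.symm]
    refine intervalIntegral.integral_congr fun r hr => ?_
    have hr' : r ∈ R c := (hR.1 c).2.1.uIcc_subset hb (hz c) hr
    simp only [Function.update_comm hcd]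
    exact hF.update_eq hR h0 (update_mem_jetBox hz hr') hs
  unfold QKdV.pd
  rw [h.deriv_eq, deriv_const]

end IsDiffFunOf

end QKdV
end

/-! ### The algebra of differential functions, its partial derivatives and vector fields -/

noncomputable section
open Set Filter Topology
namespace QKdV

variable {R : JetVar → Set ℝ}

theorem pd_congr (hR : IsJetBox R) {F F' : Jet → ℝ} (h : ∀ z ∈ jetBox R, F z = F' z)
    (c : JetVar) {z : Jet} (hz : z ∈ jetBox R) : pd c F z = pd c F' z := by
  refine Filter.EventuallyEq.deriv_eq ?_
  filter_upwards [eventually_update_mem hR hz c] with s hs using h _ hs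

theorem Dx_congr (hR : IsJetBox R) {F F' : Jet → ℝ} (h : ∀ z ∈ jetBox R, F z = F' z)
    {z : Jet} (hz : z ∈ jetBox R) : Dx F z = Dx F' z := by
  simp only [Dx, pd_congr hR h _ hz]

theorem Dt_congr (hR : IsJetBox R) {F F' : Jet → ℝ} (h : ∀ z ∈ jetBox R, F z = F' z)
    {z : Jet} (hz : z ∈ jetBox R) : Dt F z = Dt F' z := by
  simp only [Dt, pd_congr hR h _ hz]

/-- The differential functions as a subalgebra of all functions on the box. -/
def diffSubalgebra (R : JetVar → Set ℝ) : Subalgebra ℝ (jetBox R → ℝ) where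
  carrier := {a | ∃ F, IsDiffFun R F ∧ ∀ z : jetBox R, a z = F z}
  mul_mem' := by
    rintro a b ⟨F, ⟨S, hF⟩, h⟩ ⟨F', ⟨S', hF'⟩, h'⟩
    exact ⟨_, ⟨S ∪ S', (hF.mono Finset.subset_union_left).mul (hF'.mono Finset.subset_union_right)⟩,
      fun z => by simp [h, h']⟩
  add_mem' := by
    rintro a b ⟨F, ⟨S, hF⟩, h⟩ ⟨F', ⟨S', hF'⟩, h'⟩
    exact ⟨_, ⟨S ∪ S', (hF.mono Finset.subset_union_left).add (hF'.mono Finset.subset_union_right)⟩,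
      fun z => by simp [h, h']⟩
  algebraMap_mem' r := ⟨fun _ => r, ⟨∅, IsDiffFunOf.const _ r⟩, fun _ => rfl⟩

/-- The algebra of differential functions on the box. -/
def DF (R : JetVar → Set ℝ) : Type := diffSubalgebra R

namespace DF

instance : CommRing (DF R) := inferInstanceAs (CommRing (diffSubalgebra R))
instance : Algebra ℝ (DF R) := inferInstanceAs (Algebra ℝ (diffSubalgebra R))

open Classical in
/-- The value of a differential function at a jet; zero outside the box. -/
def eval (a : DF R) (z : Jet) : ℝ := if h : z ∈ jetBox R then a.1 ⟨z, h⟩ else 0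

instance : CoeFun (DF R) fun _ => Jet → ℝ := ⟨eval⟩

theorem eval_of_mem (a : DF R) {z : Jet} (hz : z ∈ jetBox R) : a z = a.1 ⟨z, hz⟩ := by
  simp [eval, hz]

@[ext]
theorem ext {a b : DF R} (h : ∀ z ∈ jetBox R, a z = b z) : a = b :=
  Subtype.ext <| funext fun z => by simpa only [eval_of_mem _ z.2] using h z z.2

theorem isDiffFun (a : DF R) : IsDiffFun R a := by
  obtain ⟨F, ⟨S, hF⟩, h⟩ := a.2
  exact ⟨S, hF.congr fun z hz => by rw [eval_of_mem a hz]; exact h ⟨z, hz⟩⟩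

/-- The element of the algebra given by a differential function. -/
def mk (F : Jet → ℝ) (hF : IsDiffFun R F) : DF R := ⟨fun z => F z, F, hF, fun _ => rfl⟩

theorem mk_apply {F : Jet → ℝ} (hF : IsDiffFun R F) {z : Jet} (hz : z ∈ jetBox R) :
    mk F hF z = F z := by
  rw [eval_of_mem _ hz]; rfl

@[simp] theorem add_apply (a b : DF R) (z : Jet) : (a + b) z = a z + b z := by
  by_cases h : z ∈ jetBox R
  · simp only [eval_of_mem _ h]; rfl
  · simp [eval, h]

@[simp] theorem mul_apply (a b : DF R) (z : Jet) : (a * b) z = a z * b z := by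
  by_cases h : z ∈ jetBox R
  · simp only [eval_of_mem _ h]; rfl
  · simp [eval, h]

@[simp] theorem neg_apply (a : DF R) (z : Jet) : (-a) z = -a z := by
  by_cases h : z ∈ jetBox R
  · simp only [eval_of_mem _ h]; rfl
  · simp [eval, h]

@[simp] theorem sub_apply (a b : DF R) (z : Jet) : (a - b) z = a z - b z := by
  simp [sub_eq_add_neg]

@[simp] theorem zero_apply (z : Jet) : (0 : DF R) z = 0 := by
  by_cases h : z ∈ jetBox R
  · simp only [eval_of_mem _ h]; rfl
  · simp [eval, h]

theorem one_apply {z : Jet} (hz : z ∈ jetBox R) : (1 : DF R) z = 1 := by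
  rw [eval_of_mem _ hz]; rfl

theorem algebraMap_apply (r : ℝ) {z : Jet} (hz : z ∈ jetBox R) : (algebraMap ℝ (DF R) r) z = r := by
  rw [eval_of_mem _ hz]; rfl

theorem natCast_apply (n : ℕ) {z : Jet} (hz : z ∈ jetBox R) : (n : DF R) z = n := by
  rw [← algebraMap_apply (n : ℝ) hz, map_natCast]

theorem ofNat_apply (n : ℕ) [n.AtLeastTwo] {z : Jet} (hz : z ∈ jetBox R) :
    (OfNat.ofNat n : DF R) z = OfNat.ofNat n := natCast_apply n hz

@[simp] theorem smul_apply (r : ℝ) (a : DF R) (z : Jet) : (r • a) z = r * a z := by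
  by_cases h : z ∈ jetBox R
  · simp only [eval_of_mem _ h]; rfl
  · simp [eval, h]

theorem pow_apply (a : DF R) (n : ℕ) {z : Jet} (hz : z ∈ jetBox R) : (a ^ n) z = a z ^ n := by
  rw [eval_of_mem _ hz, eval_of_mem _ hz]; rfl

theorem sum_apply {ι : Type*} (s : Finset ι) (a : ι → DF R) (z : Jet) :
    (∑ i ∈ s, a i) z = ∑ i ∈ s, a i z := by
  classical
  induction s using Finset.induction_on with
  | empty => simp
  | insert i s hi ih => simp [Finset.sum_insert hi, ih]

/-- The coordinate functions. -/
def X (c : JetVar) : DF R := mk (fun z => z c) ⟨{c}, IsDiffFunOf.coord (Finset.mem_singleton_self c)⟩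

theorem X_apply (c : JetVar) {z : Jet} (hz : z ∈ jetBox R) : (X c : DF R) z = z c := mk_apply _ hz

variable [hR : Fact (IsJetBox R)]

/-- The partial derivatives as derivations. -/
def del (c : JetVar) : Derivation ℝ (DF R) (DF R) :=
  Derivation.mk'
    { toFun := fun a => mk (pd c a) (let ⟨S, hS⟩ := a.isDiffFun; ⟨S, hS.pd hR.out c⟩)
      map_add' := fun a b => by
        ext z hz
        obtain ⟨S, ha⟩ := a.isDiffFun
        obtain ⟨S', hb⟩ := b.isDiffFun
        simp only [add_apply, mk_apply _ hz]
        simpa [pd, Pi.add_def] using ((ha.hasDerivAt_update hR.out hz c).add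
          (hb.hasDerivAt_update hR.out hz c)).deriv
      map_smul' := fun r a => by
        ext z hz
        simp only [smul_apply, mk_apply _ hz, RingHom.id_apply]
        simp [pd] }
    fun a b => by
      ext z hz
      obtain ⟨S, ha⟩ := a.isDiffFun
      obtain ⟨S', hb⟩ := b.isDiffFun
      have := ((ha.hasDerivAt_update hR.out hz c).mul (hb.hasDerivAt_update hR.out hz c)).deriv
      simp only [LinearMap.coe_mk, AddHom.coe_mk, smul_eq_mul, add_apply, mul_apply,
        mk_apply _ hz]
      simp only [Function.update_eq_self] at this
      rw [add_comm, mul_comm (b z), ← this]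
      simp [pd, Pi.mul_def]

theorem del_apply (c : JetVar) (a : DF R) {z : Jet} (hz : z ∈ jetBox R) :
    del c a z = pd c a z :=
  mk_apply (let ⟨S, hS⟩ := a.isDiffFun; ⟨S, hS.pd hR.out c⟩) hz

theorem del_X (c d : JetVar) : del c (X d : DF R) = if c = d then 1 else 0 := by
  ext z hz
  rw [del_apply c _ hz, pd_congr hR.out (fun z hz => X_apply d hz) c hz]
  by_cases h : c = d
  · subst h; simp [pd, one_apply hz]
  · simp [pd, h, Function.update_of_ne (Ne.symm h)]

theorem del_comm (c d : JetVar) (a : DF R) : del c (del d a) = del d (del c a) := by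
  ext z hz
  obtain ⟨S, ha⟩ := a.isDiffFun
  rw [del_apply c _ hz, del_apply d _ hz, pd_congr hR.out (fun z hz => del_apply d a hz) c hz,
    pd_congr hR.out (fun z hz => del_apply c a hz) d hz, ha.pd_comm hR.out c d hz]

theorem del_eq_zero_of_isDiffFunOf {a : DF R} {S : Finset JetVar} (ha : IsDiffFunOf R S a)
    {c : JetVar} (hc : c ∉ S) : del c a = 0 := by
  ext z hz
  rw [del_apply c a hz, ha.pd_eq_zero hR.out hc hz, zero_apply]

/-- The coordinates on which `a` depends. -/
theorem exists_support (a : DF R) : ∃ S : Finset JetVar, ∀ c, c ∉ S → del c a = 0 := by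
  obtain ⟨S, ha⟩ := a.isDiffFun
  exact ⟨S, fun c hc => del_eq_zero_of_isDiffFunOf ha hc⟩

theorem eq_algebraMap_of_del_eq_zero {a : DF R} (h : ∀ c, del c a = 0) :
    ∃ r : ℝ, a = algebraMap ℝ (DF R) r := by
  obtain ⟨z₀, hz₀⟩ := jetBox_nonempty hR.out
  obtain ⟨S, ha⟩ := a.isDiffFun
  refine ⟨a z₀, ext fun z hz => ?_⟩
  rw [algebraMap_apply _ hz]
  refine ha.eq_of_pd_eq_zero hR.out (fun c w hw => ?_) hz hz₀
  rw [← del_apply c a hw, h, zero_apply]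

theorem algebraMap_injective : Function.Injective (algebraMap ℝ (DF R)) := by
  intro r s h
  obtain ⟨z, hz⟩ := jetBox_nonempty hR.out
  rw [← algebraMap_apply r hz, h, algebraMap_apply s hz]

/-- Integration from a fixed base point in one coordinate creates no dependence on any other
coordinate. The second clause is what keeps the later order reductions from reintroducing eliminated
variables. -/
theorem exists_primitive (c : JetVar) (a : DF R) :
    ∃ b : DF R, del c b = a ∧ ∀ d, d ≠ c → del d a = 0 → del d b = 0 := by
  obtain ⟨S, ha⟩ := a.isDiffFun
  obtain ⟨r, hr⟩ := (hR.out.1 c).2.2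
  have ha' := ha.mono (Finset.subset_insert c S)
  have hb := ha'.primitive hR.out (Finset.mem_insert_self c S) hr
  refine ⟨mk _ ⟨_, hb⟩, ext fun z hz => ?_, fun d hd h0 => ext fun z hz => ?_⟩
  · rw [del_apply c _ hz, pd_congr hR.out (fun z hz => mk_apply ⟨_, hb⟩ hz) c hz,
      ha.pd_primitive_self hR.out hr hz]
  · rw [del_apply d _ hz, pd_congr hR.out (fun z hz => mk_apply ⟨_, hb⟩ hz) d hz, zero_apply]
    refine ha.pd_primitive_of_ne hR.out hd hr (fun w hw => ?_) hz
    rw [← del_apply d a hw, h0, zero_apply]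

/-- The coordinate function `c` is not a zero divisor. -/
theorem eq_zero_of_X_mul_eq_zero {c : JetVar} {a : DF R} (h : X c * a = 0) : a = 0 := by
  ext z hz
  obtain ⟨S, ha⟩ := a.isDiffFun
  rw [zero_apply]
  by_contra hne
  -- If `a z ≠ 0`, then `a` stays nonzero while coordinate `c` moves a little, so the product forces
  -- every nearby value of that coordinate to be `0`.
  have hcont : ContinuousAt (fun s => a (Function.update z c s)) (z c) :=
    (ha.hasDerivAt_update hR.out hz c).continuousAt
  have h1 : ∀ᶠ s in 𝓝 (z c), a (Function.update z c s) ≠ 0 :=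
    hcont.eventually_ne (by simpa using hne)
  have h2 : ∀ᶠ s in 𝓝 (z c), s = 0 := by
    filter_upwards [h1, eventually_update_mem hR.out hz c] with s hs hs'
    have := congrArg (fun b : DF R => b (Function.update z c s)) h
    simpa [X_apply c hs', hs] using this
  have h3 := h2.self_of_nhds
  rw [h3] at h2
  obtain ⟨ε, hε, hball⟩ := Metric.eventually_nhds_iff.1 h2
  have := @hball (ε / 2) (by simp [abs_of_pos hε]; linarith)
  linarith

/-! ### Vector fields -/

theorem finite_support_mul_del (V : JetVar → DF R) (a : DF R) :
    (Function.support fun c => V c * del c a).Finite := by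
  obtain ⟨S, hS⟩ := a.exists_support
  refine S.finite_toSet.subset fun c hc => ?_
  by_contra h
  exact hc (by simp [hS c h])

/-- The derivation `∑ V_c ∂_c`. -/
def vf (V : JetVar → DF R) : Derivation ℝ (DF R) (DF R) :=
  Derivation.mk'
    { toFun := fun a => ∑ᶠ c, V c * del c a
      map_add' := fun a b => by
        rw [← finsum_add_distrib (finite_support_mul_del V a) (finite_support_mul_del V b)]
        simp [mul_add]
      map_smul' := fun r a => by
        rw [RingHom.id_apply, smul_finsum' _ (finite_support_mul_del V a)]
        simp }
    fun a b => by
      simp only [LinearMap.coe_mk, AddHom.coe_mk, smul_eq_mul, Derivation.leibniz]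
      rw [mul_finsum' _ _ (finite_support_mul_del V b), mul_finsum' _ _ (finite_support_mul_del V a),
        ← finsum_add_distrib]
      · exact finsum_congr fun c => by ring
      · exact (finite_support_mul_del V b).subset (Function.support_mul_subset_right _ _)
      · exact (finite_support_mul_del V a).subset (Function.support_mul_subset_right _ _)

theorem vf_eq_sum (V : JetVar → DF R) {a : DF R} {S : Finset JetVar}
    (hS : ∀ c, c ∉ S → del c a = 0) : vf V a = ∑ c ∈ S, V c * del c a := by
  refine finsum_eq_sum_of_support_subset _ fun c hc => ?_
  by_contra h
  exact hc (by simp [hS c h])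

@[simp] theorem vf_X (V : JetVar → DF R) (c : JetVar) : vf V (X c) = V c := by
  rw [vf_eq_sum V (S := {c}) fun d hd => by
    rw [del_X, if_neg (by simpa using hd)]]
  simp [del_X]

/-- Partial derivatives commute, so only the differentiated coefficients contribute to the
commutator. The commutation rules with `D_x` and `D_t` are obtained by inspecting coefficients. -/
theorem del_vf (c : JetVar) (V : JetVar → DF R) (a : DF R) :
    del c (vf V a) = vf V (del c a) + vf (fun d => del c (V d)) a := by
  obtain ⟨S, hS⟩ := a.exists_support
  rw [vf_eq_sum V hS, vf_eq_sum _ hS, vf_eq_sum V (a := del c a) (S := S) fun d hd => by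
    rw [del_comm, hS d hd, map_zero], map_sum, ← Finset.sum_add_distrib]
  refine Finset.sum_congr rfl fun d _ => ?_
  rw [Derivation.leibniz, smul_eq_mul, smul_eq_mul, del_comm]
  ring

/-- The second-order terms cancel by symmetry. Hence two vector fields commute as soon as they do on
coordinates. -/
theorem vf_comm (V W : JetVar → DF R) (a : DF R) :
    vf V (vf W a) - vf W (vf V a) = vf (fun c => vf V (W c) - vf W (V c)) a := by
  obtain ⟨S, hS⟩ := a.exists_support
  have key : ∀ V W : JetVar → DF R, vf V (vf W a) = ∑ c ∈ S, vf V (W c) * del c a +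
      ∑ c ∈ S, ∑ d ∈ S, W c * V d * del d (del c a) := by
    intro V W
    rw [vf_eq_sum W hS, map_sum, ← Finset.sum_add_distrib]
    refine Finset.sum_congr rfl fun c _ => ?_
    rw [Derivation.leibniz, vf_eq_sum V (a := del c a) (S := S) fun d hd => by
      rw [del_comm, hS d hd, map_zero], smul_eq_mul, smul_eq_mul, Finset.mul_sum, add_comm,
      mul_comm]
    simp only [mul_assoc]
  rw [key, key, vf_eq_sum _ hS, Finset.sum_comm (s := S) (t := S)
    (f := fun c d => W c * V d * del d (del c a))]
  simp only [sub_mul, Finset.sum_sub_distrib]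
  have : ∀ c d, W d * V c * del c (del d a) = V c * W d * del d (del c a) := fun c d => by
    rw [del_comm]; ring
  simp only [this]
  ring

theorem vf_zero (a : DF R) : vf (fun _ => 0) a = 0 := by
  obtain ⟨S, hS⟩ := a.exists_support
  rw [vf_eq_sum _ hS]; simp

end DF
end QKdV
end

/-! ### Total derivatives, Euler operators and exactness -/

noncomputable section
open Set Filter Topology
namespace QKdV
namespace DF

variable {R : JetVar → Set ℝ}

/-- The coefficients of the vector field `D_x`. -/
def dxCoeff : JetVar → DF R
  | .t => 0
  | .x => 1
  | .u i j => X (.u i (j + 1))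

/-- The coefficients of the vector field `D_t`. -/
def dtCoeff : JetVar → DF R
  | .t => 1
  | .x => 0
  | .u i j => X (.u (i + 1) j)

variable [hR : Fact (IsJetBox R)]

/-- The total derivative `D_x`. -/
def dx : Derivation ℝ (DF R) (DF R) := vf dxCoeff

/-- The total derivative `D_t`. -/
def dt : Derivation ℝ (DF R) (DF R) := vf dtCoeff

theorem vf_indicator (c : JetVar) (a : DF R) : vf (fun d => if d = c then 1 else 0) a = del c a := by
  obtain ⟨S, hS⟩ := a.exists_support
  rw [vf_eq_sum _ (S := insert c S) fun d hd => hS d fun h => hd (Finset.mem_insert_of_mem h)]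
  simp

theorem del_one (c : JetVar) : del c (1 : DF R) = 0 := (del c).map_one_eq_zero

@[simp] theorem dx_X_t : dx (X .t : DF R) = 0 := vf_X _ _
@[simp] theorem dx_X_x : dx (X .x : DF R) = 1 := vf_X _ _
@[simp] theorem dx_X_u (i j : ℕ) : dx (X (.u i j) : DF R) = X (.u i (j + 1)) := vf_X _ _
@[simp] theorem dt_X_t : dt (X .t : DF R) = 1 := vf_X _ _
@[simp] theorem dt_X_x : dt (X .x : DF R) = 0 := vf_X _ _
@[simp] theorem dt_X_u (i j : ℕ) : dt (X (.u i j) : DF R) = X (.u (i + 1) j) := vf_X _ _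

theorem del_u_zero_dx (i : ℕ) (a : DF R) : del (.u i 0) (dx a) = dx (del (.u i 0) a) := by
  rw [dx, del_vf, add_eq_left, ← vf_zero a]
  congr 2
  funext d
  cases d <;> simp [dxCoeff, del_X]

/-- The coordinate `u_{i,j+1}` occurs in `D_x` only as the coefficient of `∂_{u_{i,j}}`. -/
theorem del_u_succ_dx (i j : ℕ) (a : DF R) :
    del (.u i (j + 1)) (dx a) = dx (del (.u i (j + 1)) a) + del (.u i j) a := by
  rw [dx, del_vf, ← vf_indicator (.u i j) a]
  congr 3
  funext d
  cases d <;> simp [dxCoeff, del_X, eq_comm]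

theorem del_u_zero_dt (j : ℕ) (a : DF R) : del (.u 0 j) (dt a) = dt (del (.u 0 j) a) := by
  rw [dt, del_vf, add_eq_left, ← vf_zero a]
  congr 2
  funext d
  cases d <;> simp [dtCoeff, del_X]

theorem del_u_succ_dt (i j : ℕ) (a : DF R) :
    del (.u (i + 1) j) (dt a) = dt (del (.u (i + 1) j) a) + del (.u i j) a := by
  rw [dt, del_vf, ← vf_indicator (.u i j) a]
  congr 3
  funext d
  cases d <;> simp [dtCoeff, del_X, eq_comm]

theorem dx_dt (a : DF R) : dx (dt a) = dt (dx a) := by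
  rw [← sub_eq_zero, dx, dt, vf_comm, ← vf_zero a]
  congr 2
  funext d
  cases d <;> simp [dxCoeff, dtCoeff]

theorem dx_eq_of_del_u_eq_zero {a : DF R} (h : ∀ i j, del (.u i j) a = 0) :
    dx a = del .x a := by
  rw [dx, vf_eq_sum _ (S := {.t, .x}) fun c hc => by
    cases c <;> simp_all]
  simp [dxCoeff]

theorem dt_eq_of_del_u_eq_zero {a : DF R} (h : ∀ i j, del (.u i j) a = 0) :
    dt a = del .t a := by
  rw [dt, vf_eq_sum _ (S := {.t, .x}) fun c hc => by
    cases c <;> simp_all]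
  simp [dtCoeff]

theorem exists_order (a : DF R) : ∃ N, ∀ i j, N ≤ i ∨ N ≤ j → del (.u i j) a = 0 := by
  obtain ⟨S, hS⟩ := a.exists_support
  refine ⟨S.sup (fun c => match c with | .u i j => i + j + 1 | _ => 0), fun i j hij => hS _ fun h => ?_⟩
  have := Finset.le_sup (f := fun c => match c with | .u i j => i + j + 1 | _ => 0) h
  simp only at this
  omega

/-! ### Euler operators with respect to `x` -/

/-- `-D_x` as a linear map. -/
def ndx : Module.End ℝ (DF R) := -dx.toLinearMap

theorem ndx_apply (a : DF R) : ndx a = -dx a := rfl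

/-- The Euler operator in the variable `∂ₜ^i u` and its `x`-derivatives, up to order `N`. -/
def euler (i N : ℕ) (a : DF R) : DF R := ∑ j ∈ Finset.range N, (ndx ^ j) (del (.u i j) a)

theorem euler_add (i N : ℕ) (a b : DF R) : euler i N (a + b) = euler i N a + euler i N b := by
  simp [euler, Finset.sum_add_distrib]

theorem euler_sub (i N : ℕ) (a b : DF R) : euler i N (a - b) = euler i N a - euler i N b := by
  simp [euler, Finset.sum_sub_distrib]

theorem euler_smul (i N : ℕ) (r : ℝ) (a : DF R) : euler i N (r • a) = r • euler i N a := by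
  simp [euler, Finset.smul_sum]

theorem euler_eq_of_le {i N N' : ℕ} {a : DF R} (h : ∀ j, N ≤ j → del (.u i j) a = 0)
    (hN : N ≤ N') : euler i N' a = euler i N a := by
  refine (Finset.sum_subset (Finset.range_mono hN) fun j _ hj => ?_).symm
  rw [h j (by simpa using hj), map_zero]

/-- By `del_u_succ_dx` the sum telescopes, leaving only the boundary term of the truncation, which
is zero once `N` exceeds the order of `a`. -/
theorem euler_dx (i N : ℕ) (a : DF R) :
    euler i (N + 1) (dx a) = -(ndx ^ (N + 1)) (del (.u i N) a) := by
  induction N with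
  | zero => simp [euler, del_u_zero_dx, ndx_apply]
  | succ N ih =>
    rw [euler, Finset.sum_range_succ, ← euler, ih, del_u_succ_dx, map_add,
      pow_succ ndx (N + 1), Module.End.mul_apply, ndx_apply, map_neg]
    ring

theorem euler_dx_eq_zero {i N : ℕ} {a : DF R} (h : ∀ j, N ≤ j → del (.u i j) a = 0) {N' : ℕ}
    (hN : N < N') : euler i N' (dx a) = 0 := by
  obtain ⟨k, rfl⟩ : ∃ k, N' = k + 1 := ⟨N' - 1, by omega⟩
  rw [euler_dx, h k (by omega), map_zero, neg_zero]

theorem ndx_pow_dt (k : ℕ) (a : DF R) : (ndx ^ k) (dt a) = dt ((ndx ^ k) a) := by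
  induction k generalizing a with
  | zero => rfl
  | succ k ih => rw [pow_succ, Module.End.mul_apply, Module.End.mul_apply, ndx_apply, ndx_apply,
      dx_dt, ← map_neg, ih]

theorem euler_zero_dt (N : ℕ) (a : DF R) : euler 0 N (dt a) = dt (euler 0 N a) := by
  simp only [euler, map_sum]
  exact Finset.sum_congr rfl fun j _ => by rw [del_u_zero_dt, ndx_pow_dt]

/-- The extra term comes from the commutator of `D_t` with `∂_{u_{i+1,j}}`. It links consecutive
Euler operators and permits the descent in `i`. -/
theorem euler_succ_dt (i N : ℕ) (a : DF R) :
    euler (i + 1) N (dt a) = dt (euler (i + 1) N a) + euler i N a := by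
  simp only [euler, map_sum, ← Finset.sum_add_distrib]
  exact Finset.sum_congr rfl fun j _ => by rw [del_u_succ_dt, map_add, ndx_pow_dt]

theorem del_ndx_pow_eq_zero {i n : ℕ} {a : DF R} (h : ∀ j, n ≤ j → del (.u i j) a = 0) (k : ℕ) :
    ∀ j, n + k ≤ j → del (.u i j) ((ndx ^ k) a) = 0 := by
  induction k with
  | zero => simpa using h
  | succ k ih =>
    intro j hj
    obtain ⟨l, rfl⟩ : ∃ l, j = l + 1 := ⟨j - 1, by omega⟩
    rw [pow_succ', Module.End.mul_apply, ndx_apply, map_neg, del_u_succ_dx, ih _ (by omega),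
      ih _ (by omega), map_zero, add_zero, neg_zero]

/-- Each `-D_x` raises the order by one and passes the top coefficient on with a sign. -/
theorem del_ndx_pow_top {i n : ℕ} {a : DF R} (h : ∀ j, n < j → del (.u i j) a = 0) (k : ℕ) :
    del (.u i (n + k)) ((ndx ^ k) a) = (-1) ^ k * del (.u i n) a := by
  induction k with
  | zero => simp
  | succ k ih =>
    rw [pow_succ', Module.End.mul_apply, ndx_apply, map_neg, ← add_assoc, del_u_succ_dx, ih,
      del_ndx_pow_eq_zero (n := n + 1) (fun j hj => h j hj) k _ (by omega), map_zero]
    ring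

/-- A density that is annihilated by one Euler operator is equivalent to a density that does not
depend on the corresponding variable. -/
theorem exists_eliminate (i n : ℕ) : ∀ T : DF R, (∀ j, n ≤ j → del (.u i j) T = 0) →
    euler i n T = 0 → ∃ Θ : DF R, (∀ j, del (.u i j) (T - dx Θ) = 0) ∧
      ∀ i', (∀ j, del (.u i' j) T = 0) → ∀ j, del (.u i' j) (T - dx Θ) = 0 := by
  induction n with
  | zero => exact fun T hT _ => ⟨0, by simpa using hT, by simp⟩
  | succ n ih =>
    intro T hT hE
    rcases n with _ | m
    · have h0 : del (.u i 0) T = 0 := by simpa [euler] using hE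
      refine ⟨0, fun j => ?_, by simp⟩
      rcases j with _ | j
      · simpa using h0
      · simpa using hT (j + 1) (by omega)
    have hTj : ∀ k j, m + 2 ≤ j → del (.u i j) (del (.u i k) T) = 0 := fun k j hj => by
      rw [del_comm, hT j hj, map_zero]
    -- The derivative of `E_i T` in `u_{i,2m+2}` sees only the last summand and is `±` the second
    -- derivative of `T` in its top variable. So `T` is affine in that variable.
    have htop : del (.u i (m + 1)) (del (.u i (m + 1)) T) = 0 := by
      have h1 := congrArg (del (.u i (m + 1 + (m + 1)))) hE
      rw [euler, Finset.sum_range_succ, map_add, map_sum, map_zero,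
        Finset.sum_eq_zero fun j hj => ?_, zero_add,
        del_ndx_pow_top fun j hj => hTj _ j hj] at h1
      · have h2 : ((-1 : DF R) ^ (m + 1)) * (-1) ^ (m + 1) = 1 := by
          rw [← mul_pow]; simp
        rw [← one_mul (del (.u i (m + 1)) (del (.u i (m + 1)) T)), ← h2, mul_assoc, h1, mul_zero]
      · have := Finset.mem_range.1 hj
        exact del_ndx_pow_eq_zero (hTj j) j _ (by omega)
    -- `D_x Φ` has the same coefficient of `u_{i,m+1}` as `T`, so subtracting it lowers the order.
    obtain ⟨Φ, hΦ, hΦ'⟩ := exists_primitive (.u i m) (del (.u i (m + 1)) T)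
    have hΦj : ∀ j, m + 1 ≤ j → del (.u i j) Φ = 0 := by
      intro j hj
      refine hΦ' _ (by simp; omega) ?_
      rcases hj.eq_or_lt with rfl | hj
      · exact htop
      · exact hTj _ _ hj
    have hT' : ∀ j, m + 1 ≤ j → del (.u i j) (T - dx Φ) = 0 := by
      intro j hj
      obtain ⟨l, rfl⟩ : ∃ l, j = l + 1 := ⟨j - 1, by omega⟩
      rw [map_sub, del_u_succ_dx, hΦj _ hj, map_zero, zero_add]
      rcases hj.eq_or_lt with h | hj
      · obtain rfl : m = l := by omega
        rw [hΦ, sub_self]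
      · rw [hT _ (by omega), hΦj l (by omega), sub_self]
    obtain ⟨Θ, hΘ, hΘ'⟩ := ih (T - dx Φ) hT' (by
      rw [← euler_eq_of_le hT' (Nat.le_succ _), euler_sub, hE,
        euler_dx_eq_zero hΦj (Nat.lt_succ_self _), sub_zero])
    refine ⟨Φ + Θ, fun j => ?_, fun i' hi' j => ?_⟩
    · rw [map_add, ← sub_sub]; exact hΘ j
    · rw [map_add, ← sub_sub]
      by_cases hii : i' = i
      · subst hii; exact hΘ j
      refine hΘ' i' (fun j => ?_) j
      have h0 : ∀ j, del (.u i' j) Φ = 0 := fun j =>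
        hΦ' _ (by simp [hii]) (by rw [del_comm, hi', map_zero])
      rcases j with _ | j
      · rw [map_sub, hi', del_u_zero_dx, h0, map_zero, sub_zero]
      · rw [map_sub, hi', del_u_succ_dx, h0, h0, map_zero, add_zero, sub_zero]

/-- Densities annihilated by all Euler operators are total `x`-derivatives. -/
theorem exists_dx_eq {T : DF R} (hT : ∀ i, ∃ N₀, ∀ N, N₀ ≤ N → euler i N T = 0) :
    ∃ Θ, T = dx Θ := by
  obtain ⟨M, hM⟩ := T.exists_order
  -- The families `∂ₜ^i u` are removed one `i` at a time, without bringing back those already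
  -- removed or those absent from `T`.
  have step : ∀ k, ∃ Θ, ∀ i, i < k ∨ M ≤ i → ∀ j, del (.u i j) (T - dx Θ) = 0 := by
    intro k
    induction k with
    | zero => exact ⟨0, fun i hi j => by simpa using hM i j (Or.inl (by omega))⟩
    | succ k ih =>
      obtain ⟨Θ, hΘ⟩ := ih
      obtain ⟨N₀, hN₀⟩ := hT k
      obtain ⟨N₁, hN₁⟩ := Θ.exists_order
      obtain ⟨N₂, hN₂⟩ := (T - dx Θ).exists_order
      obtain ⟨Φ, hΦ, hΦ'⟩ := exists_eliminate k (max N₀ (max (N₁ + 1) N₂)) (T - dx Θ)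
        (fun j hj => hN₂ k j (Or.inr (by omega))) (by
          rw [euler_sub, hN₀ _ (by omega), euler_dx_eq_zero (N := N₁)
            (fun j hj => hN₁ k j (Or.inr hj)) (by omega), sub_zero])
      refine ⟨Θ + Φ, fun i hi j => ?_⟩
      rw [map_add, ← sub_sub]
      by_cases hik : i = k
      · subst hik; exact hΦ j
      · exact hΦ' i (hΘ i (by omega)) j
  obtain ⟨Θ, hΘ⟩ := step M
  have h0 : ∀ i j, del (.u i j) (T - dx Θ) = 0 := fun i j => hΘ i (by omega) j
  -- What is left depends on `t` and `x` only and is integrated in `x`.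
  obtain ⟨Φ, hΦ, hΦ'⟩ := exists_primitive .x (T - dx Θ)
  refine ⟨Θ + Φ, ?_⟩
  rw [map_add, dx_eq_of_del_u_eq_zero (a := Φ) fun i j => hΦ' _ (by simp) (h0 i j), hΦ]
  ring

/-- Now `∂_{u_{i,j}} a = -D_x ∂_{u_{i,j+1}} a`, so vanishing descends from beyond the order of `a`.
-/
theorem del_u_eq_zero_of_dx_eq_zero {a : DF R} (h : dx a = 0) (i j : ℕ) : del (.u i j) a = 0 := by
  obtain ⟨N, hN⟩ := a.exists_order
  by_cases hj : N ≤ j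
  · exact hN i j (Or.inr hj)
  · have hle : j ≤ N := by omega
    clear hj
    induction hle using Nat.decreasingInduction with
    | self => exact hN i N (Or.inr le_rfl)
    | of_succ k hk ih =>
      have h1 := del_u_succ_dx i k a
      rw [h, map_zero, ih, map_zero, zero_add] at h1
      exact h1.symm

/-- If the total divergence of `(T, Y)` is the equation `u_t + g` times `Q`, and `g` and `Q` contain
no `t`-derivatives, then `Q` is the variational derivative of `T`. -/
theorem euler_eq_multiplier {T Y g Q : DF R} (h : dt T + dx Y = (X (.u 1 0) + g) * Q)
    (hg : ∀ i j, del (.u (i + 1) j) g = 0) (hQ : ∀ i j, del (.u (i + 1) j) Q = 0) :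
    ∃ N₀, ∀ N, N₀ ≤ N → (∀ i, euler (i + 1) N T = 0) ∧ euler 0 N T = Q ∧
      dt Q = euler 0 N ((X (.u 1 0) + g) * Q) := by
  obtain ⟨M, hM⟩ := T.exists_order
  obtain ⟨M', hM'⟩ := Y.exists_order
  -- The truncation must strictly exceed the order of `Y` for `E_i D_x Y` to vanish.
  refine ⟨max M (M' + 1), fun N hN => ?_⟩
  have hY : ∀ i, euler i N (dx Y) = 0 := fun i =>
    euler_dx_eq_zero (N := M') (fun j hj => hM' i j (Or.inr hj)) (by omega)
  have hs : ∀ i, dt (euler (i + 1) N T) + euler i N T =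
      euler (i + 1) N ((X (.u 1 0) + g) * Q) := fun i => by
    rw [← h, euler_add, hY, add_zero, euler_succ_dt]
  have hd : ∀ i j, del (.u (i + 1) j) ((X (.u 1 0) + g) * Q) =
      if i = 0 ∧ j = 0 then Q else 0 := by
    intro i j
    rw [Derivation.leibniz, hQ, map_add, hg, del_X]
    by_cases hij : i = 0 ∧ j = 0 <;> simp [hij]
  have h2 : ∀ i, euler (i + 2) N ((X (.u 1 0) + g) * Q) = 0 := fun i =>
    Finset.sum_eq_zero fun j _ => by rw [hd]; simp
  have h1 : euler 1 N ((X (.u 1 0) + g) * Q) = Q := by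
    rw [euler, Finset.sum_eq_single 0]
    · simpa using hd 0 0
    · intro j _ hj
      have := hd 0 j
      simp only [hj, and_false, if_false, zero_add] at this
      rw [this, map_zero]
    · intro h; exact absurd (Finset.mem_range.2 (by omega)) h
  -- Descending induction: `E_{i+2}` of the right-hand side is zero, so `E_{i+1} T = -D_t E_{i+2}
  -- T`.
  have hpos : ∀ i, euler (i + 1) N T = 0 := by
    intro i
    by_cases hi : M ≤ i
    · exact Finset.sum_eq_zero fun j _ => by rw [hM _ _ (Or.inl (by omega)), map_zero]
    · have hle : i ≤ M := by omega
      clear hi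
      induction hle using Nat.decreasingInduction with
      | self => exact Finset.sum_eq_zero fun j _ => by rw [hM _ _ (Or.inl (by omega)), map_zero]
      | of_succ k hk ih =>
        have := hs (k + 1)
        rwa [h2, ih, map_zero, zero_add] at this
  have hzero : euler 0 N T = Q := by
    have := hs 0
    rwa [hpos 0, map_zero, zero_add, h1] at this
  refine ⟨hpos, hzero, ?_⟩
  rw [← h, euler_add, hY, add_zero, euler_zero_dt, hzero]

/-- Identically conserved densities are trivial. -/
theorem exists_potential {T Y : DF R} (h : dt T + dx Y = 0) :
    ∃ Θ, T = dx Θ ∧ Y = -dt Θ := by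
  obtain ⟨N₀, hN₀⟩ := euler_eq_multiplier (T := T) (Y := Y) (g := 0) (Q := 0) (by rw [h]; ring)
    (by simp) (by simp)
  obtain ⟨Θ, rfl⟩ := exists_dx_eq (T := T) fun i => ⟨N₀, fun N hN => by
    rcases i with _ | i
    · exact (hN₀ N hN).2.1
    · exact (hN₀ N hN).1 i⟩
  -- Hence `Y + D_t Θ` is a function of `t` alone. Its primitive in `t` is absorbed into the
  -- potential without changing `D_x Θ`.
  have h1 : dx (Y + dt Θ) = 0 := by rw [map_add, dx_dt, add_comm, h]
  have h2 := del_u_eq_zero_of_dx_eq_zero h1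
  obtain ⟨Ψ, hΨ, hΨ'⟩ := exists_primitive .t (Y + dt Θ)
  have h3 : ∀ i j, del (.u i j) Ψ = 0 := fun i j => hΨ' _ (by simp) (h2 i j)
  refine ⟨Θ - Ψ, ?_, ?_⟩
  · rw [map_sub, dx_eq_of_del_u_eq_zero h3,
      hΨ' _ (by simp) (by rw [← dx_eq_of_del_u_eq_zero h2, h1]), sub_zero]
  · rw [map_sub, dt_eq_of_del_u_eq_zero h3, hΨ]
    ring

end DF
end QKdV
end

/-! ### The solution space as a graph over the `x`-jets -/

noncomputable section
open Set Filter Topology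
namespace QKdV
namespace DF

variable {R : JetVar → Set ℝ}

/-- The function `F` is represented on the box by the element `a`. -/
def Represents (a : DF R) (F : Jet → ℝ) : Prop := ∀ z ∈ jetBox R, F z = a z

theorem represents_mk {F : Jet → ℝ} (hF : IsDiffFun R F) : Represents (mk F hF) F :=
  fun _ hz => (mk_apply hF hz).symm

theorem iterate_map_eq_zero (D : Derivation ℝ (DF R) (DF R)) (n : ℕ) : D^[n] 0 = 0 :=
  Function.iterate_fixed D.map_zero n

theorem exists_isDiffFunOf_finset (v : JetVar → DF R) (S : Finset JetVar) :
    ∃ S', ∀ c ∈ S, IsDiffFunOf R S' (v c) := by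
  choose T hT using fun c => (v c).isDiffFun
  exact ⟨S.biUnion T, fun c hc => (hT c).mono (Finset.subset_biUnion_of_mem T hc)⟩

variable [hR : Fact (IsJetBox R)]

/-! ### Comparison with the total derivatives of functions -/

theorem vf_apply_eq_finsum (V : JetVar → DF R) (a : DF R) {z : Jet} (hz : z ∈ jetBox R) :
    vf V a z = V .t z * pd .t a z + V .x z * pd .x a z +
      ∑ᶠ p : ℕ × ℕ, V (.u p.1 p.2) z * pd (.u p.1 p.2) a z := by
  obtain ⟨N, hN⟩ := a.exists_order
  let I : Finset (ℕ × ℕ) := Finset.range N ×ˢ Finset.range N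
  let S : Finset JetVar := insert .t (insert .x (I.image fun p => .u p.1 p.2))
  have hinj : Function.Injective fun p : ℕ × ℕ => JetVar.u p.1 p.2 := by
    rintro ⟨i, j⟩ ⟨k, l⟩ h
    simpa using h
  have hI : ∀ p : ℕ × ℕ, p ∉ I → del (.u p.1 p.2) a = 0 := fun p hp => hN _ _ (by
    simp only [I, Finset.mem_product, Finset.mem_range] at hp; omega)
  have hS : ∀ c, c ∉ S → del c a = 0 := by
    intro c hc
    cases c with
    | t => simp [S] at hc
    | x => simp [S] at hc
    | u i j => exact hI (i, j) fun h => hc (by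
        simp only [S, Finset.mem_insert, Finset.mem_image]
        exact Or.inr (Or.inr ⟨(i, j), h, rfl⟩))
  rw [vf_eq_sum V hS, Finset.sum_insert (by simp), Finset.sum_insert (by simp),
    Finset.sum_image fun p _ q _ h => hinj h, finsum_eq_sum_of_support_subset (s := I)]
  · simp only [add_apply, mul_apply, sum_apply, del_apply _ _ hz]
    ring
  · intro p hp
    by_contra h
    exact hp (by simp [← del_apply _ _ hz, hI p (by simpa using h)])

theorem Dx_eval (a : DF R) {z : Jet} (hz : z ∈ jetBox R) : Dx a z = dx a z := by
  rw [dx, vf_apply_eq_finsum _ _ hz]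
  simp [Dx, dxCoeff, one_apply hz, X_apply _ hz]

theorem Dt_eval (a : DF R) {z : Jet} (hz : z ∈ jetBox R) : Dt a z = dt a z := by
  rw [dt, vf_apply_eq_finsum _ _ hz]
  simp [Dt, dtCoeff, one_apply hz, X_apply _ hz]

namespace Represents

theorem Dx {a : DF R} {F : Jet → ℝ} (h : Represents a F) : Represents (dx a) (QKdV.Dx F) :=
  fun z hz => by rw [Dx_congr hR.out h hz, Dx_eval a hz]

theorem Dt {a : DF R} {F : Jet → ℝ} (h : Represents a F) : Represents (dt a) (QKdV.Dt F) :=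
  fun z hz => by rw [Dt_congr hR.out h hz, Dt_eval a hz]

theorem Dx_iterate {a : DF R} {F : Jet → ℝ} (h : Represents a F) (j : ℕ) :
    Represents (dx^[j] a) (QKdV.Dx^[j] F) := by
  induction j with
  | zero => exact h
  | succ j ih => simpa only [Function.iterate_succ_apply'] using ih.Dx

theorem Dt_iterate {a : DF R} {F : Jet → ℝ} (h : Represents a F) (j : ℕ) :
    Represents (dt^[j] a) (QKdV.Dt^[j] F) := by
  induction j with
  | zero => exact h
  | succ j ih => simpa only [Function.iterate_succ_apply'] using ih.Dt

end Represents

/-! ### The solution space as a graph over the `x`-jets -/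

/-- The coefficients of the vector field that is `D_t` on the solutions of `u_t = K`. -/
def evolCoeff (K : DF R) : JetVar → DF R
  | .t => 1
  | .x => 0
  | .u 0 j => dx^[j] K
  | .u (_ + 1) _ => 0

/-- The evolutionary time derivative of functions of the `x`-jets, for `u_t = K`. -/
def evol (K : DF R) : Derivation ℝ (DF R) (DF R) := vf (evolCoeff K)

/-- The coefficient of the evolution at `u_{0,j+1}` is `D_x` of that at `u_{0,j}`, so the commutator
has zero coefficients. -/
theorem dx_evol (K a : DF R) : dx (evol K a) = evol K (dx a) := by
  rw [← sub_eq_zero, dx, evol, vf_comm, ← vf_zero a]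
  congr 2
  funext d
  rcases d with _ | _ | ⟨_ | i, j⟩
  · simp [dxCoeff, evolCoeff]
  · simp [dxCoeff, evolCoeff]
  · change dx (dx^[j] K) - vf (evolCoeff K) (X (.u 0 (j + 1))) = 0
    rw [vf_X, evolCoeff, Function.iterate_succ_apply', sub_self]
  · simp [dxCoeff, evolCoeff]

/-- The jet coordinates of solutions of `u_t = K`, as functions of the `x`-jet. -/
def solCoord (K : DF R) : JetVar → DF R
  | .t => X .t
  | .x => X .x
  | .u i j => dx^[j] ((evol K)^[i] (X (.u 0 0)))

theorem dx_iterate_X (j : ℕ) : dx^[j] (X (.u 0 0) : DF R) = X (.u 0 j) := by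
  induction j with
  | zero => rfl
  | succ j ih => rw [Function.iterate_succ_apply', ih, dx_X_u]

theorem solCoord_zero (K : DF R) (j : ℕ) : solCoord K (.u 0 j) = X (.u 0 j) := dx_iterate_X j

theorem solCoord_u_one (K : DF R) : solCoord K (.u 1 0) = K := by
  simp [solCoord, evol, evolCoeff]

/-- The jet of a solution of `u_t = K` with the same `x`-jet as `z`. -/
def solJet (K : DF R) (z : Jet) : Jet := fun c => solCoord K c z

theorem solJet_mem (K : DF R) {z : Jet} (hz : z ∈ jetBox R) : solJet K z ∈ jetBox R := by
  intro c
  rcases c with _ | _ | ⟨_ | i, j⟩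
  · simpa [solJet, solCoord, X_apply _ hz] using hz .t
  · simpa [solJet, solCoord, X_apply _ hz] using hz .x
  · simpa [solJet, solCoord_zero, X_apply _ hz] using hz (.u 0 j)
  -- The values of the `t`-derivatives are dictated by the equation, which is why their coordinates
  -- must be unrestricted.
  · rw [hR.out.2]; trivial

theorem isDiffFun_comp_solJet (K a : DF R) : IsDiffFun R fun z => a (solJet K z) := by
  obtain ⟨S, hS⟩ := a.isDiffFun
  obtain ⟨S', hS'⟩ := exists_isDiffFunOf_finset (solCoord K) S
  exact ⟨S', hS.comp hR.out (fun z hz => solJet_mem K hz) hS'⟩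

/-- Restriction of differential functions to the solutions of `u_t = K`. -/
def pull (K a : DF R) : DF R := mk (fun z => a (solJet K z)) (isDiffFun_comp_solJet K a)

theorem pull_apply (K a : DF R) {z : Jet} (hz : z ∈ jetBox R) : pull K a z = a (solJet K z) :=
  mk_apply _ hz

theorem pull_X (K : DF R) (c : JetVar) : pull K (X c) = solCoord K c := by
  ext z hz
  rw [pull_apply K _ hz, X_apply c (solJet_mem K hz), solJet]

theorem pull_one (K : DF R) : pull K 1 = 1 := by
  ext z hz
  rw [pull_apply K _ hz, one_apply (solJet_mem K hz), one_apply hz]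

theorem pull_zero (K : DF R) : pull K 0 = 0 := by
  ext z hz
  rw [pull_apply K _ hz, zero_apply, zero_apply]

theorem del_pull (K a : DF R) {S : Finset JetVar} (hS : IsDiffFunOf R S a) (d : JetVar) :
    del d (pull K a) = ∑ c ∈ S, del d (solCoord K c) * pull K (del c a) := by
  obtain ⟨S', hS'⟩ := exists_isDiffFunOf_finset (solCoord K) S
  ext z hz
  rw [del_apply d _ hz, pd_congr hR.out (fun z hz => pull_apply K a hz) d hz,
    hS.pd_comp hR.out (fun z hz => solJet_mem K hz) hS' d hz, sum_apply]
  refine Finset.sum_congr rfl fun c _ => ?_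
  rw [mul_apply, pull_apply K _ hz, del_apply _ _ (solJet_mem K hz), del_apply d _ hz]
  rfl

/-- The chain rule reduces intertwining relations to the coordinates. It yields that restriction to
solutions commutes with `D_x` and turns `D_t` into `evol K`. -/
theorem vf_pull (K : DF R) {V W : JetVar → DF R} (h : ∀ c, vf V (solCoord K c) = pull K (W c))
    (a : DF R) : vf V (pull K a) = pull K (vf W a) := by
  obtain ⟨S, hS⟩ := a.isDiffFun
  have h1 : vf V (pull K a) = ∑ c ∈ S, vf V (solCoord K c) * pull K (del c a) := by
    change ∑ᶠ d, V d * del d (pull K a) = ∑ c ∈ S, (∑ᶠ d, V d * del d (solCoord K c)) * _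
    simp only [del_pull K a hS, Finset.mul_sum]
    rw [finsum_sum_comm]
    · refine Finset.sum_congr rfl fun c _ => ?_
      rw [finsum_mul' _ _ (finite_support_mul_del V (solCoord K c))]
      exact finsum_congr fun d => by ring
    · intro c _
      refine (finite_support_mul_del V (solCoord K c)).subset fun d hd => ?_
      rw [Function.mem_support] at hd ⊢
      rw [← mul_assoc] at hd
      exact left_ne_zero_of_mul hd
  rw [h1, vf_eq_sum W fun c hc => del_eq_zero_of_isDiffFunOf hS hc]
  ext z hz
  rw [pull_apply K _ hz, sum_apply, sum_apply]
  refine Finset.sum_congr rfl fun c _ => ?_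
  rw [h, mul_apply, mul_apply, pull_apply K _ hz, pull_apply K _ hz]

theorem dx_pull (K a : DF R) : dx (pull K a) = pull K (dx a) := by
  refine vf_pull K (fun c => ?_) a
  change dx _ = _
  rcases c with _ | _ | ⟨i, j⟩
  · simp [solCoord, dxCoeff, pull_zero]
  · simp [solCoord, dxCoeff, pull_one]
  · simp [solCoord, dxCoeff, pull_X, Function.iterate_succ_apply']

theorem evol_dx_iterate (K a : DF R) (j : ℕ) : evol K (dx^[j] a) = dx^[j] (evol K a) := by
  induction j with
  | zero => rfl
  | succ j ih => rw [Function.iterate_succ_apply', ← dx_evol, ih, Function.iterate_succ_apply']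

theorem evol_pull (K a : DF R) : evol K (pull K a) = pull K (dt a) := by
  refine vf_pull K (fun c => ?_) a
  change evol K _ = _
  rcases c with _ | _ | ⟨i, j⟩
  · simp [solCoord, dtCoeff, pull_one, evol, evolCoeff]
  · simp [solCoord, dtCoeff, pull_zero, evol, evolCoeff]
  · simp [solCoord, dtCoeff, pull_X, evol_dx_iterate, Function.iterate_succ_apply']

theorem pull_dt_dx_iterate (K a : DF R) (i j : ℕ) :
    pull K (dt^[i] (dx^[j] a)) = (evol K)^[i] (dx^[j] (pull K a)) := by
  induction i with
  | zero =>
    induction j with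
    | zero => rfl
    | succ j ih => simpa [Function.iterate_succ_apply', ← dx_pull] using congrArg dx ih
  | succ i ih => rw [Function.iterate_succ_apply', ← evol_pull, ih, Function.iterate_succ_apply']

/-- Functions of `x`-jets are not changed by the restriction to solutions. -/
theorem pull_eq_self (K : DF R) {a : DF R} {S : Finset JetVar} (ha : IsDiffFunOf R S a)
    (hS : ∀ i j, JetVar.u (i + 1) j ∉ S) : pull K a = a := by
  ext z hz
  rw [pull_apply K _ hz]
  obtain ⟨g, -, hg⟩ := ha
  rw [hg z hz, hg _ (solJet_mem K hz)]
  congr 1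
  funext ⟨c, hc⟩
  rcases c with _ | _ | ⟨_ | i, j⟩
  · simp [solJet, solCoord, X_apply _ hz]
  · simp [solJet, solCoord, X_apply _ hz]
  · simp [solJet, solCoord_zero, X_apply _ hz]
  · exact absurd hc (hS i j)

/-- If the equation is `u_t + g = 0`, then the solution jets for `u_t = -g` lie in the
solution space. -/
theorem solJet_mem_solSpace {f : ℝ → ℝ} {g : DF R} (hpde : Represents (X (.u 1 0) + g) (pde f))
    (hg : pull (-g) g = g) {z : Jet} (hz : z ∈ jetBox R) : solJet (-g) z ∈ solSpace R f := by
  refine ⟨solJet_mem _ hz, fun i j => ?_⟩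
  have h0 : pull (-g) (X (.u 1 0) + g) = 0 := by
    ext w hw
    rw [pull_apply _ _ hw, add_apply, ← pull_apply _ _ hw, ← pull_apply _ _ hw, pull_X,
      solCoord_u_one, hg, neg_apply, neg_add_cancel, zero_apply]
  rw [(hpde.Dx_iterate j).Dt_iterate i _ (solJet_mem _ hz), ← pull_apply _ _ hz,
    pull_dt_dx_iterate, h0, iterate_map_eq_zero, iterate_map_eq_zero, zero_apply]

end DF
end QKdV
end

/-! ### The explicit conservation laws in characteristic form -/

noncomputable section
open Set Filter Topology
namespace QKdV
namespace DF

variable {R : JetVar → Set ℝ}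

/-- A smooth function of `u`. -/
def ofU (φ : ℝ → ℝ) (hφ : ContDiffOn ℝ ∞ φ (R (.u 0 0))) : DF R :=
  mk (fun z => φ (cu z)) ⟨{.u 0 0}, IsDiffFunOf.comp_coord (Finset.mem_singleton_self _) hφ⟩

theorem ofU_apply {φ : ℝ → ℝ} (hφ : ContDiffOn ℝ ∞ φ (R (.u 0 0))) {z : Jet} (hz : z ∈ jetBox R) :
    ofU φ hφ z = φ (z (.u 0 0)) := mk_apply _ hz

variable [hR : Fact (IsJetBox R)]

theorem del_ofU_of_ne {φ : ℝ → ℝ} (hφ : ContDiffOn ℝ ∞ φ (R (.u 0 0))) {c : JetVar}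
    (hc : c ≠ .u 0 0) : del c (ofU φ hφ) = 0 :=
  del_eq_zero_of_isDiffFunOf (S := {.u 0 0})
    ((IsDiffFunOf.comp_coord (Finset.mem_singleton_self _) hφ).congr fun _ hz => ofU_apply hφ hz)
    (by simpa using hc)

theorem del_ofU {φ ψ : ℝ → ℝ} (hφ : ContDiffOn ℝ ∞ φ (R (.u 0 0)))
    (hψ : ContDiffOn ℝ ∞ ψ (R (.u 0 0))) (h : ∀ v ∈ R (.u 0 0), HasDerivAt φ (ψ v) v) :
    del (.u 0 0) (ofU φ hφ) = ofU ψ hψ := by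
  ext z hz
  rw [del_apply _ _ hz, pd_congr hR.out (fun z hz => ofU_apply hφ hz) _ hz, ofU_apply hψ hz, pd]
  simpa using (h _ (hz (.u 0 0))).deriv

theorem dx_of_del_eq_zero {a : DF R} (h : ∀ c, c ≠ .u 0 0 → del c a = 0) :
    dx a = X (.u 0 1) * del (.u 0 0) a := by
  rw [dx, vf_eq_sum _ (S := {.u 0 0}) fun c hc => h c (by simpa using hc)]
  simp [dxCoeff]

theorem dt_of_del_eq_zero {a : DF R} (h : ∀ c, c ≠ .u 0 0 → del c a = 0) :
    dt a = X (.u 1 0) * del (.u 0 0) a := by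
  rw [dt, vf_eq_sum _ (S := {.u 0 0}) fun c hc => h c (by simpa using hc)]
  simp [dtCoeff]

/-- The flux `u (u u_x)_x + f(u)` of the mass, for `f(u) = φ`. -/
def massFlux (φ : DF R) : DF R := X (.u 0 0) ^ 2 * X (.u 0 2) + X (.u 0 0) * X (.u 0 1) ^ 2 + φ

theorem momentum_identity {φ φ' η : DF R} (hφ : dx φ = X (.u 0 1) * φ')
    (hη : dx η = X (.u 0 1) * (X (.u 0 0) * φ')) :
    dt ((1 / 2 : ℝ) • X (.u 0 0) ^ 2) +
      dx (X (.u 0 0) ^ 3 * X (.u 0 2) + (1 / 2 : ℝ) • (X (.u 0 0) ^ 2 * X (.u 0 1) ^ 2) + η) =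
    (X (.u 1 0) + dx (massFlux φ)) * X (.u 0 0) := by
  ext z hz
  simp [massFlux, Derivation.leibniz_pow, hφ, hη, pow_apply _ _ hz, ofNat_apply _ hz]
  ring

/-- The density has variational derivative `-M`, with `M` the mass flux, so `D_t T = -u_t M + D_x
(u² u_x u_t)`. Since `M D_x M = D_x (M²/2)`, the flux is `-M²/2 - u² u_t u_x`. -/
theorem energy_identity {φ φ' Φ : DF R} (hφ : dx φ = X (.u 0 1) * φ')
    (hΦ : dt Φ = X (.u 1 0) * φ) :
    dt ((1 / 2 : ℝ) • (X (.u 0 0) ^ 2 * X (.u 0 1) ^ 2) - Φ) +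
      dx (-((1 / 2 : ℝ) • (X (.u 0 0) ^ 4 * X (.u 0 2) ^ 2)) -
        X (.u 0 0) ^ 3 * X (.u 0 1) ^ 2 * X (.u 0 2) -
        (1 / 2 : ℝ) • (X (.u 0 0) ^ 2 * X (.u 0 1) ^ 4) -
        X (.u 0 0) ^ 2 * X (.u 1 0) * X (.u 0 1) - φ * X (.u 0 0) ^ 2 * X (.u 0 2) -
        φ * X (.u 0 0) * X (.u 0 1) ^ 2 - (1 / 2 : ℝ) • φ ^ 2) =
    (X (.u 1 0) + dx (massFlux φ)) * -massFlux φ := by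
  ext z hz
  simp [massFlux, Derivation.leibniz_pow, hφ, hΦ, pow_apply _ _ hz, ofNat_apply _ hz]
  ring

/-- The multiplier of the additional conservation law. -/
def extraMultiplier (f₀ f₁ : ℝ) : DF R :=
  (2 : ℝ) • (X .t * (X (.u 0 0) ^ 2 * X (.u 0 2) + X (.u 0 0) * X (.u 0 1) ^ 2)) +
    (2 * f₀) • (X .t * X (.u 0 0) ^ 5) + (2 / 5 * f₁) • (X .t * X (.u 0 0)) -
    (2 / 5 : ℝ) • (X .x * X (.u 0 0))

/-- The density of the additional conservation law. -/
def extraDensity (f₀ f₁ : ℝ) : DF R :=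
  (1 / 3 * f₀) • (X .t * X (.u 0 0) ^ 6) - X .t * X (.u 0 0) ^ 2 * X (.u 0 1) ^ 2 +
    (1 / 5 : ℝ) • ((f₁ • X .t - X .x) * X (.u 0 0) ^ 2)

/-- The flux of the additional conservation law. -/
def extraFlux (f₀ f₁ : ℝ) : DF R :=
  (2 * f₀) • (X .t * X (.u 0 0) ^ 7 * X (.u 0 2)) + X .t * X (.u 0 0) ^ 4 * X (.u 0 2) ^ 2 +
    (2 : ℝ) • (X .t * X (.u 0 0) ^ 3 * X (.u 0 1) ^ 2 * X (.u 0 2)) +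
    (2 / 5 * f₁) • (X .t * X (.u 0 0) ^ 3 * X (.u 0 2)) -
    (2 / 5 : ℝ) • (X .x * X (.u 0 0) ^ 3 * X (.u 0 2)) +
    (2 / 5 : ℝ) • (X (.u 0 0) ^ 3 * X (.u 0 1)) + X .t * X (.u 0 0) ^ 2 * X (.u 0 1) ^ 4 -
    (1 / 5 : ℝ) • (X .x * X (.u 0 0) ^ 2 * X (.u 0 1) ^ 2) +
    (2 : ℝ) • (X .t * X (.u 0 0) ^ 2 * X (.u 1 0) * X (.u 0 1)) +
    (2 * f₀) • (X .t * X (.u 0 0) ^ 6 * X (.u 0 1) ^ 2) +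
    (6 / 5 * f₁) • (X .t * X (.u 0 0) ^ 2 * X (.u 0 1) ^ 2) +
    (f₀ ^ 2) • (X .t * X (.u 0 0) ^ 10) + (2 / 3 * f₀ * f₁) • (X .t * X (.u 0 0) ^ 6) -
    (1 / 3 * f₀) • (X .x * X (.u 0 0) ^ 6) + (1 / 5 * f₁ ^ 2) • (X .t * X (.u 0 0) ^ 2) -
    (1 / 5 * f₁) • (X .x * X (.u 0 0) ^ 2)

/-- The constant `f₂` disappears because only `D_x` of the mass flux enters. -/
theorem extra_identity (f₀ f₁ f₂ : ℝ) :
    dt (extraDensity f₀ f₁ : DF R) + dx (extraFlux f₀ f₁) =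
      (X (.u 1 0) + dx (massFlux (f₀ • X (.u 0 0) ^ 5 + f₁ • X (.u 0 0) + f₂ • 1))) *
        extraMultiplier f₀ f₁ := by
  ext z hz
  simp [massFlux, extraMultiplier, extraDensity, extraFlux, Derivation.leibniz_pow,
    pow_apply _ _ hz, ofNat_apply _ hz]
  ring

end DF

variable {R : JetVar → Set ℝ}

open DF

/-- The coordinates `t, x, u, u_x, u_xx` of low-order multipliers. -/
abbrev lowCoords : Finset JetVar := {.t, .x, .u 0 0, .u 0 1, .u 0 2}

namespace DF
namespace Represents

theorem add {a b : DF R} {F F' : Jet → ℝ} (h : Represents a F) (h' : Represents b F') :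
    Represents (a + b) (F + F') := fun z hz => by simp [h z hz, h' z hz]

theorem sub {a b : DF R} {F F' : Jet → ℝ} (h : Represents a F) (h' : Represents b F') :
    Represents (a - b) (F - F') := fun z hz => by simp [h z hz, h' z hz]

theorem smul (r : ℝ) {a : DF R} {F : Jet → ℝ} (h : Represents a F) :
    Represents (r • a) (r • F) := fun z hz => by simp [h z hz]

theorem isDiffFun {a : DF R} {F : Jet → ℝ} (h : Represents a F) : IsDiffFun R F := by
  obtain ⟨S, hS⟩ := DF.isDiffFun a
  exact ⟨S, hS.congr h⟩

end Represents

/-- Invariance under the restriction to solutions; it holds for functions of `x`-jets. -/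
def IsSpatial [Fact (IsJetBox R)] (a : DF R) : Prop := ∀ K, pull K a = a

section
variable [hR : Fact (IsJetBox R)]

theorem pull_add (K a b : DF R) : pull K (a + b) = pull K a + pull K b := by
  ext z hz; simp [pull_apply _ _ hz]

theorem pull_sub (K a b : DF R) : pull K (a - b) = pull K a - pull K b := by
  ext z hz; simp [pull_apply _ _ hz]

theorem pull_mul (K a b : DF R) : pull K (a * b) = pull K a * pull K b := by
  ext z hz; simp [pull_apply _ _ hz]

theorem pull_smul (K : DF R) (r : ℝ) (a : DF R) : pull K (r • a) = r • pull K a := by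
  ext z hz; simp [pull_apply _ _ hz]

theorem pull_pow (K a : DF R) (n : ℕ) : pull K (a ^ n) = pull K a ^ n := by
  ext z hz; simp [pull_apply _ _ hz, pow_apply _ _ hz, pow_apply _ _ (solJet_mem K hz)]

theorem pull_ofU (K : DF R) {φ : ℝ → ℝ} (hφ : ContDiffOn ℝ ∞ φ (R (.u 0 0))) :
    pull K (ofU φ hφ) = ofU φ hφ :=
  pull_eq_self (S := {.u 0 0}) K
    ((IsDiffFunOf.comp_coord (Finset.mem_singleton_self _) hφ).congr fun _ hz => ofU_apply hφ hz)
    (by simp)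

theorem pull_X_t (K : DF R) : pull K (X .t) = X .t := pull_X K _
theorem pull_X_x (K : DF R) : pull K (X .x) = X .x := pull_X K _
theorem pull_X_u (K : DF R) (j : ℕ) : pull K (X (.u 0 j)) = X (.u 0 j) := by
  rw [pull_X, solCoord_zero]

theorem IsSpatial.add {a b : DF R} (ha : IsSpatial a) (hb : IsSpatial b) : IsSpatial (a + b) :=
  fun K => by rw [pull_add, ha, hb]

theorem IsSpatial.sub {a b : DF R} (ha : IsSpatial a) (hb : IsSpatial b) : IsSpatial (a - b) :=
  fun K => by rw [pull_sub, ha, hb]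

theorem IsSpatial.smul (r : ℝ) {a : DF R} (ha : IsSpatial a) : IsSpatial (r • a) :=
  fun K => by rw [pull_smul, ha]

end
end DF

/-! ### Multipliers and equivalence of conservation laws -/

section
variable [hR : Fact (IsJetBox R)] {f : ℝ → ℝ}

/-- The left-hand side of the equation as an element of the algebra. -/
def eqn (hf : ContDiffOn ℝ ∞ f (R (.u 0 0))) : DF R := X (.u 1 0) + dx (massFlux (ofU f hf))

theorem represents_eqn (hf : ContDiffOn ℝ ∞ f (R (.u 0 0))) : Represents (eqn hf) (pde f) := by
  have h1 : Represents (X (.u 0 0) * X (.u 0 1) : DF R) (fun v => cu v * cux v) := fun z hz => by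
    simp [X_apply _ hz]
  have h2 : Represents (massFlux (ofU f hf))
      (fun w => cu w * Dx (fun v => cu v * cux v) w + f (cu w)) := fun z hz => by
    simp only [h1.Dx z hz]
    simp [massFlux, X_apply _ hz, ofU_apply hf hz, pow_apply _ _ hz]
    ring
  intro z hz
  simp [pde, eqn, h2.Dx z hz, X_apply _ hz]

theorem pull_dx_massFlux (K : DF R) (hf : ContDiffOn ℝ ∞ f (R (.u 0 0))) :
    pull K (dx (massFlux (ofU f hf))) = dx (massFlux (ofU f hf)) := by
  rw [← dx_pull]
  simp only [massFlux, pull_add, pull_mul, pull_pow, pull_X_u, pull_ofU]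

theorem del_dx_massFlux (hf : ContDiffOn ℝ ∞ f (R (.u 0 0))) (i j : ℕ) :
    del (.u (i + 1) j) (dx (massFlux (ofU f hf))) = 0 := by
  have h : ∀ j, del (.u (i + 1) j) (massFlux (ofU f hf)) = 0 := fun j => by
    simp [massFlux, Derivation.leibniz_pow, del_X, del_ofU_of_ne]
  rcases j with _ | j
  · rw [del_u_zero_dx, h, map_zero]
  · rw [del_u_succ_dx, h, h, map_zero, add_zero]

/-- `(T, X)` has, on the whole box, the characteristic form with multiplier `q`. -/
def HasCharForm (hf : ContDiffOn ℝ ∞ f (R (.u 0 0))) (L : Pair) (q : DF R) : Prop :=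
  ∃ T Y : DF R, Represents T L.1 ∧ Represents Y L.2 ∧ dt T + dx Y = eqn hf * q

/-- A characteristic form whose density is a function of `x`-jets. -/
def HasSpatialForm (hf : ContDiffOn ℝ ∞ f (R (.u 0 0))) (L : Pair) (q : DF R) : Prop :=
  ∃ T Y : DF R, Represents T L.1 ∧ Represents Y L.2 ∧ IsSpatial T ∧ dt T + dx Y = eqn hf * q

variable {hf : ContDiffOn ℝ ∞ f (R (.u 0 0))}

theorem HasSpatialForm.hasCharForm {L : Pair} {q : DF R} (h : HasSpatialForm hf L q) :
    HasCharForm hf L q := by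
  obtain ⟨T, Y, hT, hY, -, h⟩ := h
  exact ⟨T, Y, hT, hY, h⟩

theorem HasSpatialForm.add {L L' : Pair} {q q' : DF R} (h : HasSpatialForm hf L q)
    (h' : HasSpatialForm hf L' q') : HasSpatialForm hf (L + L') (q + q') := by
  obtain ⟨T, Y, hT, hY, hs, h⟩ := h
  obtain ⟨T', Y', hT', hY', hs', h'⟩ := h'
  refine ⟨T + T', Y + Y', hT.add hT', hY.add hY', hs.add hs', ?_⟩
  rw [map_add, map_add, mul_add, ← h, ← h']
  ring

theorem HasSpatialForm.smul (r : ℝ) {L : Pair} {q : DF R} (h : HasSpatialForm hf L q) :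
    HasSpatialForm hf (r • L) (r • q) := by
  obtain ⟨T, Y, hT, hY, hs, h⟩ := h
  refine ⟨r • T, r • Y, hT.smul r, hY.smul r, hs.smul r, ?_⟩
  rw [Derivation.map_smul, Derivation.map_smul, ← smul_add, h, mul_smul_comm]

theorem HasCharForm.isLowOrderLaw {L : Pair} {q : DF R} (h : HasCharForm hf L q)
    (hq : IsDiffFunOf R lowCoords q) : IsLowOrderLaw R f L := by
  obtain ⟨T, Y, hT, hY, h⟩ := h
  have key : ∀ z ∈ jetBox R, Dt L.1 z + Dx L.2 z = pde f z * q z := fun z hz => by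
    rw [hT.Dt z hz, hY.Dx z hz, ← add_apply, h, mul_apply, represents_eqn hf z hz]
  refine ⟨⟨hT.isDiffFun, hY.isDiffFun, fun z hz => ?_⟩, q, hq, L, hT.isDiffFun, hY.isDiffFun,
    fun z _ => ⟨rfl, rfl⟩, key⟩
  rw [key z hz.1, show pde f z = 0 from hz.2 0 0, zero_mul]

theorem IsLowOrderLaw.exists_hasCharForm (hf : ContDiffOn ℝ ∞ f (R (.u 0 0))) {L : Pair}
    (h : IsLowOrderLaw R f L) : ∃ L' q, HasCharForm hf L' q ∧ IsDiffFunOf R lowCoords q ∧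
      ∀ z ∈ solSpace R f, L'.1 z = L.1 z ∧ L'.2 z = L.2 z := by
  obtain ⟨-, Q, hQ, L', h1, h2, hsol, h⟩ := h
  refine ⟨L', mk Q ⟨_, hQ⟩, ⟨mk _ h1, mk _ h2, represents_mk h1, represents_mk h2, ?_⟩,
    hQ.congr fun z hz => mk_apply ⟨_, hQ⟩ hz, hsol⟩
  ext z hz
  rw [add_apply, mul_apply, ← (represents_mk h1).Dt z hz, ← (represents_mk h2).Dx z hz, h z hz,
    represents_eqn hf z hz, mk_apply ⟨_, hQ⟩ hz]

/-- Conservation laws with the same multiplier are equivalent. -/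
theorem HasCharForm.equivLaw {L L' A : Pair} {q : DF R} (h : HasCharForm hf L' q)
    (hA : HasCharForm hf A q) (hL : ∀ z ∈ solSpace R f, L'.1 z = L.1 z ∧ L'.2 z = L.2 z) :
    EquivLaw R f L A := by
  obtain ⟨T, Y, hT, hY, h⟩ := h
  obtain ⟨T', Y', hT', hY', h'⟩ := hA
  -- The difference of the two laws has multiplier zero, so it is conserved identically, off
  -- solutions too.
  obtain ⟨Θ, hΘ, hΘ'⟩ := exists_potential (T := T - T') (Y := Y - Y') (by
    rw [map_sub, map_sub]; linear_combination h - h')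
  refine ⟨Θ, Θ.isDiffFun, fun z hz => ?_⟩
  rw [← (hL z hz).1, ← (hL z hz).2, Dx_eval Θ hz.1, Dt_eval Θ hz.1, ← neg_apply, ← hΘ, ← hΘ',
    hT z hz.1, hT' z hz.1, hY z hz.1, hY' z hz.1, sub_apply, sub_apply]
  exact ⟨rfl, rfl⟩

theorem HasCharForm.dt_eq_euler {L : Pair} {q : DF R} (h : HasCharForm hf L q)
    (hq : ∀ i j, del (.u (i + 1) j) q = 0) :
    ∃ N₀, ∀ N, N₀ ≤ N → dt q = euler 0 N (eqn hf * q) := by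
  obtain ⟨T, Y, -, -, h⟩ := h
  obtain ⟨N₀, hN⟩ := euler_eq_multiplier h (del_dx_massFlux hf) hq
  exact ⟨N₀, fun N hN' => (hN N hN').2.2⟩

/-- Equivalent conservation laws have the same multiplier. -/
theorem HasSpatialForm.eq_of_equivLaw {L A B : Pair} {q q' : DF R} (hA : HasSpatialForm hf A q)
    (hB : HasSpatialForm hf B q') (hq : ∀ i j, del (.u (i + 1) j) q = 0)
    (hq' : ∀ i j, del (.u (i + 1) j) q' = 0) (hLA : EquivLaw R f L A) (hLB : EquivLaw R f L B) :
    q = q' := by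
  obtain ⟨T, Y, hT, hY, hs, h⟩ := hA
  obtain ⟨T', Y', hT', hY', hs', h'⟩ := hB
  obtain ⟨Θ, hΘ, hA⟩ := hLA
  obtain ⟨Θ', hΘ', hB⟩ := hLB
  set K : DF R := -dx (massFlux (ofU f hf))
  -- On the solution space `T - T' = D_x (Θ' - Θ)`. Pulled back along the solution jets this holds
  -- on the whole box, because the spatial function `T - T'` is unchanged and `pull` commutes with
  -- `D_x`.
  obtain ⟨θ, hθ⟩ : ∃ θ, T - T' = dx θ := by
    refine ⟨pull K (mk Θ' hΘ' - mk Θ hΘ), ?_⟩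
    rw [dx_pull, ← (hs.sub hs') K]
    ext z hz
    have hsol : solJet K z ∈ solSpace R f :=
      solJet_mem_solSpace (represents_eqn hf) (pull_dx_massFlux _ hf) hz
    rw [pull_apply _ _ hz, pull_apply _ _ hz, map_sub, sub_apply, sub_apply,
      ← (represents_mk hΘ).Dx _ hsol.1, ← (represents_mk hΘ').Dx _ hsol.1, ← (hA _ hsol).1,
      ← (hB _ hsol).1, ← hT _ hsol.1, ← hT' _ hsol.1]
    ring
  obtain ⟨N₀, hN⟩ := euler_eq_multiplier (T := T - T') (Y := Y - Y') (Q := q - q')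
    (g := dx (massFlux (ofU f hf))) (by
      rw [map_sub, map_sub, mul_sub]
      rw [eqn] at h h'
      linear_combination h - h') (del_dx_massFlux hf)
    (fun i j => by rw [map_sub, hq, hq', sub_zero])
  obtain ⟨N₁, hN₁⟩ := θ.exists_order
  -- `q - q'` is the variational derivative of `T - T'`, a total `x`-derivative.
  have h1 := (hN (max N₀ (N₁ + 1)) (le_max_left _ _)).2.1
  rw [hθ, euler_dx_eq_zero (N := N₁) (fun j hj => hN₁ 0 j (Or.inr hj)) (by omega)] at h1
  exact sub_eq_zero.1 h1.symm

end
end QKdV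
end

/-! ### The determining equation: leading terms -/

noncomputable section
open Set Filter Topology
namespace QKdV
namespace DF

variable {R : JetVar → Set ℝ}

@[simp] theorem derivation_ofNat (D : Derivation ℝ (DF R) (DF R)) (n : ℕ) [n.AtLeastTwo] :
    D ofNat(n) = 0 := D.map_natCast n

theorem ofNat_mul_cancel (n : ℕ) [n.AtLeastTwo] {a b : DF R}
    (h : (ofNat(n) : DF R) * a = ofNat(n) * b) : a = b := by
  ext z hz
  have := congrArg (fun w : DF R => w z) h
  simpa [ofNat_apply _ hz] using this

variable [hR : Fact (IsJetBox R)] {f : ℝ → ℝ}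

theorem X_mul_cancel (c : JetVar) {a b : DF R} (h : X c * a = X c * b) : a = b :=
  sub_eq_zero.1 (eq_zero_of_X_mul_eq_zero (c := c) (by rw [mul_sub, h, sub_self]))

/-- Dependence on the coordinates `t, x, u, u_x, u_xx` only. -/
def IsLow (a : DF R) : Prop := ∀ c, c ∉ lowCoords → del c a = 0

theorem IsLow.del {a : DF R} (ha : IsLow a) (d : JetVar) : IsLow (del d a) := fun c hc => by
  rw [del_comm, ha c hc, map_zero]

theorem IsLow.del_u_add_three {a : DF R} (ha : IsLow a) (j : ℕ) : DF.del (.u 0 (j + 3)) a = 0 :=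
  ha _ (by simp)

theorem IsLow.del_u_succ {a : DF R} (ha : IsLow a) (i j : ℕ) : DF.del (.u (i + 1) j) a = 0 :=
  ha _ (by simp)

theorem IsLow.dx_eq {a : DF R} (ha : IsLow a) : dx a = DF.del .x a + X (.u 0 1) * DF.del (.u 0 0) a +
    X (.u 0 2) * DF.del (.u 0 1) a + X (.u 0 3) * DF.del (.u 0 2) a := by
  rw [dx, vf_eq_sum _ ha]
  simp [dxCoeff]
  ring

theorem IsLow.dt_eq {a : DF R} (ha : IsLow a) : dt a = DF.del .t a + X (.u 1 0) * DF.del (.u 0 0) a +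
    X (.u 1 1) * DF.del (.u 0 1) a + X (.u 1 2) * DF.del (.u 0 2) a := by
  rw [dt, vf_eq_sum _ ha]
  simp [dtCoeff]
  ring

theorem dx_ofU (hf : ContDiffOn ℝ ∞ f (R (.u 0 0))) :
    dx (ofU f hf) = X (.u 0 1) * del (.u 0 0) (ofU f hf) :=
  dx_of_del_eq_zero fun _ hc => del_ofU_of_ne hf hc

theorem dx_massFlux (hf : ContDiffOn ℝ ∞ f (R (.u 0 0))) : dx (massFlux (ofU f hf)) =
    X (.u 0 0) ^ 2 * X (.u 0 3) + 4 * X (.u 0 0) * X (.u 0 1) * X (.u 0 2) + X (.u 0 1) ^ 3 +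
      X (.u 0 1) * del (.u 0 0) (ofU f hf) := by
  simp [massFlux, Derivation.leibniz_pow, dx_ofU]
  ring

/-- The product has `x`-order three, so the Euler sum stops at `j = 3`. The explicit factors are the
partial derivatives of the equation. -/
theorem euler_eqn_mul {hf : ContDiffOn ℝ ∞ f (R (.u 0 0))} {q : DF R} (hq : IsLow q)
    {N : ℕ} (hN : 4 ≤ N) :
    euler 0 N (eqn hf * q) =
      (2 * X (.u 0 0) * X (.u 0 3) + 4 * X (.u 0 1) * X (.u 0 2) +
          X (.u 0 1) * del (.u 0 0) (del (.u 0 0) (ofU f hf))) * q +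
        eqn hf * del (.u 0 0) q -
      dx ((4 * X (.u 0 0) * X (.u 0 2) + 3 * X (.u 0 1) ^ 2 + del (.u 0 0) (ofU f hf)) * q +
        eqn hf * del (.u 0 1) q) +
      dx (dx (4 * X (.u 0 0) * X (.u 0 1) * q + eqn hf * del (.u 0 2) q)) -
      dx (dx (dx (X (.u 0 0) ^ 2 * q))) := by
  have hφ : ∀ c, c ≠ .u 0 0 → del c (del (.u 0 0) (ofU f hf)) = 0 := fun c hc => by
    rw [del_comm, del_ofU_of_ne hf hc, map_zero]
  have h4 : ∀ j, 4 ≤ j → del (.u 0 j) (eqn hf * q) = 0 := by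
    intro j hj
    obtain ⟨k, rfl⟩ : ∃ k, j = k + 4 := ⟨j - 4, by omega⟩
    have := hq.del_u_add_three (k + 1)
    simp [eqn, dx_massFlux, Derivation.leibniz_pow, del_X, hφ, this]
  rw [euler_eq_of_le h4 hN]
  have h0 : del (.u 0 0) (eqn hf) = 2 * X (.u 0 0) * X (.u 0 3) + 4 * X (.u 0 1) * X (.u 0 2) +
      X (.u 0 1) * del (.u 0 0) (del (.u 0 0) (ofU f hf)) := by
    simp [eqn, dx_massFlux, Derivation.leibniz_pow, del_X]
    ring
  have h1 : del (.u 0 1) (eqn hf) = 4 * X (.u 0 0) * X (.u 0 2) + 3 * X (.u 0 1) ^ 2 +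
      del (.u 0 0) (ofU f hf) := by
    simp [eqn, dx_massFlux, Derivation.leibniz_pow, del_X, hφ]
    ring
  have h2 : del (.u 0 2) (eqn hf) = 4 * X (.u 0 0) * X (.u 0 1) := by
    simp [eqn, dx_massFlux, Derivation.leibniz_pow, del_X, hφ]
  have h3 : del (.u 0 3) (eqn hf) = X (.u 0 0) ^ 2 := by
    simp [eqn, dx_massFlux, Derivation.leibniz_pow, del_X, hφ]
  simp only [euler, Finset.sum_range_succ, Finset.sum_range_zero, zero_add, pow_zero, pow_succ,
    Module.End.mul_apply, Module.End.one_apply, ndx_apply, map_neg, neg_neg,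
    Derivation.leibniz _ (eqn hf) q, h0, h1, h2, h3, smul_eq_mul,
    hq.del_u_add_three 0, mul_zero]
  ring_nf

/-- Compare the coefficients of `u_tx`. The left side gives `q_{u_x}`, and the terms `-D_x (u_t
q_{u_x}) + D_x² (u_t q_{u_xx})` on the right give `-q_{u_x} + 2 D_x q_{u_xx}`. This is the Helmholtz
condition on a variational derivative. -/
theorem multiplier_self_adjoint {hf : ContDiffOn ℝ ∞ f (R (.u 0 0))} {q : DF R} (hq : IsLow q)
    {N₀ : ℕ} (h : ∀ N, N₀ ≤ N → dt q = euler 0 N (eqn hf * q)) :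
    del (.u 0 1) q = dx (del (.u 0 2) q) := by
  have hE : ∀ j, del (.u 1 j) (eqn hf) = if j = 0 then 1 else 0 := fun j => by
    rw [eqn, map_add, del_dx_massFlux hf 0 j, add_zero, del_X]; simp
  have hφ : ∀ j, del (.u 1 j) (ofU f hf) = 0 := fun j => del_ofU_of_ne hf (by simp)
  have hφ' : ∀ j, del (.u 1 j) (del (.u 0 0) (ofU f hf)) = 0 := fun j => by
    rw [del_comm, hφ, map_zero]
  have hφ'' : ∀ j, del (.u 1 j) (del (.u 0 0) (del (.u 0 0) (ofU f hf))) = 0 := fun j => by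
    rw [del_comm, hφ', map_zero]
  have h0 : ∀ j, del (.u 1 j) q = 0 := fun j => hq.del_u_succ 0 j
  have h1 : ∀ c j, del (.u 1 j) (del c q) = 0 := fun c j => (hq.del c).del_u_succ 0 j
  have h2 := congrArg (del (.u 1 1)) ((h _ (le_max_left N₀ 4)).trans (euler_eqn_mul hq (le_max_right N₀ 4)))
  rw [hq.dt_eq] at h2
  simp only [map_add, map_sub, Derivation.leibniz, Derivation.leibniz_pow, del_X, hE, hφ', hφ'',
    h0, h1, del_u_succ_dx 1 0, del_u_zero_dx, derivation_ofNat, smul_eq_mul, nsmul_eq_mul] at h2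
  simp at h2
  refine ofNat_mul_cancel 2 ?_
  linear_combination h2

/-- In the self-adjointness relation `q_{u_x}` contains no `u_xxx`, so `q` is affine in `u_xx`. With
`q_{u_x}` eliminated, the `u_xxxx`-coefficient of the determining equation is the second relation
times `3u`, up to sign. -/
theorem multiplier_top_equation {hf : ContDiffOn ℝ ∞ f (R (.u 0 0))} {q : DF R} (hq : IsLow q)
    {N₀ : ℕ} (h : ∀ N, N₀ ≤ N → dt q = euler 0 N (eqn hf * q)) :
    del (.u 0 2) (del (.u 0 2) q) = 0 ∧
    X (.u 0 0) * dx (del (.u 0 2) q) = 2 * X (.u 0 1) * del (.u 0 2) q := by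
  have h01 := multiplier_self_adjoint hq h
  have hq3 : ∀ c, del (.u 0 3) (del c q) = 0 := fun c => (hq.del c).del_u_add_three 0
  have hq4 : ∀ c, del (.u 0 4) (del c q) = 0 := fun c => (hq.del c).del_u_add_three 1
  have hq30 : del (.u 0 3) q = 0 := hq.del_u_add_three 0
  have hq40 : del (.u 0 4) q = 0 := hq.del_u_add_three 1
  have h22 : del (.u 0 2) (del (.u 0 2) q) = 0 := by
    have := congrArg (del (.u 0 3)) h01
    rw [del_u_succ_dx, hq3, hq3, map_zero, zero_add] at this
    exact this.symm
  refine ⟨h22, ?_⟩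
  have hφ : ∀ j, del (.u 0 (j + 1)) (ofU f hf) = 0 := fun j => del_ofU_of_ne hf (by simp)
  have hφ' : ∀ j, del (.u 0 (j + 1)) (del (.u 0 0) (ofU f hf)) = 0 := fun j => by
    rw [del_comm, hφ, map_zero]
  have hφ'' : ∀ j, del (.u 0 (j + 1)) (del (.u 0 0) (del (.u 0 0) (ofU f hf))) = 0 := fun j => by
    rw [del_comm, hφ', map_zero]
  have h2 := congrArg (del (.u 0 4)) ((h _ (le_max_left N₀ 4)).trans (euler_eqn_mul hq (le_max_right N₀ 4)))
  rw [hq.dt_eq, eqn, dx_massFlux] at h2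
  simp only [map_add, map_sub, Derivation.leibniz, Derivation.leibniz_pow, del_X, hφ' 3, hφ'' 3, hφ' 2, hφ' 1,
    hq3, hq4, hq30, hq40, h22, del_u_succ_dx 0 3, del_u_succ_dx 0 2,
    del_u_succ_dx 0 1, derivation_ofNat, smul_eq_mul, nsmul_eq_mul] at h2
  simp at h2
  refine X_mul_cancel (.u 0 0) (ofNat_mul_cancel 3 ?_)
  rw [h01] at h2
  linear_combination h2

end DF
end QKdV
end

/-! ### Reduction to multipliers `c(t) M + k(t, x, u)` -/

noncomputable section
open Set Filter Topology
namespace QKdV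
namespace DF

variable {R : JetVar → Set ℝ} [hR : Fact (IsJetBox R)] {f : ℝ → ℝ}

theorem exists_eq_smul_one {a : DF R} (h : ∀ c, del c a = 0) : ∃ r : ℝ, a = r • (1 : DF R) := by
  obtain ⟨r, hr⟩ := eq_algebraMap_of_del_eq_zero h
  exact ⟨r, by rw [hr, Algebra.algebraMap_eq_smul_one]⟩

/-- The solution of `u D_x a = 2 u_x a`. -/
theorem leading_coefficient {a : DF R} (ha : IsLow a) (h2 : del (.u 0 2) a = 0)
    (h : X (.u 0 0) * dx a = 2 * X (.u 0 1) * a) :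
    a = (1 / 2 : ℝ) • del (.u 0 0) (del (.u 0 0) a) * X (.u 0 0) ^ 2 ∧
      ∀ c, c ≠ .t → del c (del (.u 0 0) (del (.u 0 0) a)) = 0 := by
  have h2' : ∀ c, del (.u 0 2) (del c a) = 0 := fun c => by rw [del_comm, h2, map_zero]
  rw [ha.dx_eq, h2] at h
  -- The equation splits by powers of the jets: `u_xx` gives `a_{u_x} = 0`, `u_x` gives `u a_u =
  -- 2a`, and the rest gives `a_x = 0`.
  have h1 : del (.u 0 1) a = 0 := by
    have := congrArg (del (.u 0 2)) h
    simp [Derivation.leibniz, del_X, h2, h2'] at this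
    exact eq_zero_of_X_mul_eq_zero this
  have h1' : ∀ c, del (.u 0 1) (del c a) = 0 := fun c => by rw [del_comm, h1, map_zero]
  have h0 : X (.u 0 0) * del (.u 0 0) a = 2 * a := by
    have := congrArg (del (.u 0 1)) h
    simp [Derivation.leibniz, del_X, h1, h1'] at this
    linear_combination this
  have hx : del .x a = 0 := by
    refine eq_zero_of_X_mul_eq_zero (c := .u 0 0) ?_
    rw [h1] at h
    linear_combination h - X (.u 0 1) * h0
  -- Differentiating `u a_u = 2a` exhibits the coefficient of `u²` as `a_uu / 2`, which avoids
  -- dividing by `u²`.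
  have h00 : X (.u 0 0) * del (.u 0 0) (del (.u 0 0) a) = del (.u 0 0) a := by
    have := congrArg (del (.u 0 0)) h0
    simp [Derivation.leibniz, del_X] at this
    linear_combination this
  have h000 : del (.u 0 0) (del (.u 0 0) (del (.u 0 0) a)) = 0 := by
    have := congrArg (del (.u 0 0)) h00
    simp [Derivation.leibniz, del_X] at this
    exact eq_zero_of_X_mul_eq_zero this
  constructor
  · refine ofNat_mul_cancel 2 ?_
    have h3 : (2 : DF R) * ((1 / 2 : ℝ) • del (.u 0 0) (del (.u 0 0) a) * X (.u 0 0) ^ 2) =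
        del (.u 0 0) (del (.u 0 0) a) * X (.u 0 0) ^ 2 := by
      ext z hz
      simp [ofNat_apply _ hz]
    rw [h3]
    linear_combination -h0 - X (.u 0 0) * h00
  · intro c hc
    by_cases hlow : c ∈ lowCoords
    · simp only [lowCoords, Finset.mem_insert, Finset.mem_singleton] at hlow
      rcases hlow with rfl | rfl | rfl | rfl | rfl
      · exact absurd rfl hc
      · rw [del_comm, del_comm .x, hx, map_zero, map_zero]
      · exact h000
      · rw [del_comm, del_comm (.u 0 1), h1, map_zero, map_zero]
      · rw [del_comm, del_comm (.u 0 2), h2, map_zero, map_zero]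
    · exact (ha.del _).del _ c hlow

theorem ndx_pow_mul {c : DF R} (hc : dx c = 0) (j : ℕ) (a : DF R) :
    (ndx ^ j) (c * a) = c * (ndx ^ j) a := by
  induction j generalizing a with
  | zero => rfl
  | succ j ih =>
    rw [pow_succ, Module.End.mul_apply, Module.End.mul_apply, ← ih]
    simp [ndx_apply, hc]

theorem euler_mul {c : DF R} (i N : ℕ) (hc : dx c = 0) (hc' : ∀ j, del (.u i j) c = 0) (a : DF R) :
    euler i N (c * a) = c * euler i N a := by
  simp [euler, Finset.mul_sum, hc', ndx_pow_mul hc]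

/-- Dependence on the coordinates `t, x, u` only. -/
def IsBase (a : DF R) : Prop := ∀ c, c ∉ ({.t, .x, .u 0 0} : Finset JetVar) → del c a = 0

theorem IsBase.del {a : DF R} (ha : IsBase a) (d : JetVar) : IsBase (del d a) := fun c hc => by
  rw [del_comm, ha c hc, map_zero]

theorem IsBase.isLow {a : DF R} (ha : IsBase a) : IsLow a := fun c hc => ha c fun h => hc (by
  simp only [Finset.mem_insert, Finset.mem_singleton] at h ⊢
  tauto)

theorem IsBase.dx_eq {a : DF R} (ha : IsBase a) :
    dx a = DF.del .x a + X (.u 0 1) * DF.del (.u 0 0) a := by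
  rw [ha.isLow.dx_eq, ha (.u 0 1) (by simp), ha (.u 0 2) (by simp)]
  ring

theorem IsBase.dt_eq {a : DF R} (ha : IsBase a) :
    dt a = DF.del .t a + X (.u 1 0) * DF.del (.u 0 0) a := by
  rw [ha.isLow.dt_eq, ha (.u 0 1) (by simp), ha (.u 0 2) (by simp)]
  ring

theorem isBase_ofU (hf : ContDiffOn ℝ ∞ f (R (.u 0 0))) : IsBase (ofU f hf) :=
  fun _ hc => del_ofU_of_ne hf fun h => hc (by simp [h])

/-- The determining equation for multipliers `c (u²u_xx + u u_x² + f(u)) + k(t, x, u)`. -/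
theorem base_determining_equation {hf : ContDiffOn ℝ ∞ f (R (.u 0 0))} {k c' : DF R}
    (hk : IsBase k) {N : ℕ} (hN : 4 ≤ N)
    (h : dt k + c' * massFlux (ofU f hf) = euler 0 N (eqn hf * k)) :
    c' * massFlux (ofU f hf) + del .t k =
      del (.u 0 0) k * (X (.u 0 0) ^ 2 * X (.u 0 3) + 4 * X (.u 0 0) * X (.u 0 1) * X (.u 0 2) +
        X (.u 0 1) ^ 3 + X (.u 0 1) * del (.u 0 0) (ofU f hf)) -
      (X (.u 0 0) ^ 2 * (del .x (del .x (del .x k)) +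
          3 * X (.u 0 1) * del .x (del .x (del (.u 0 0) k)) +
          3 * X (.u 0 1) ^ 2 * del .x (del (.u 0 0) (del (.u 0 0) k)) +
          X (.u 0 1) ^ 3 * del (.u 0 0) (del (.u 0 0) (del (.u 0 0) k)) +
          3 * X (.u 0 2) * del .x (del (.u 0 0) k) +
          3 * X (.u 0 1) * X (.u 0 2) * del (.u 0 0) (del (.u 0 0) k) +
          X (.u 0 3) * del (.u 0 0) k) +
        2 * X (.u 0 0) * X (.u 0 1) * (del .x (del .x k) + 2 * X (.u 0 1) * del .x (del (.u 0 0) k) +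
          X (.u 0 1) ^ 2 * del (.u 0 0) (del (.u 0 0) k) + X (.u 0 2) * del (.u 0 0) k) +
        (2 * X (.u 0 0) * X (.u 0 2) + X (.u 0 1) ^ 2 + del (.u 0 0) (ofU f hf)) *
          (del .x k + X (.u 0 1) * del (.u 0 0) k)) := by
  have hφ := isBase_ofU hf
  have hxu : ∀ b : DF R, del (.u 0 0) (del .x b) = del .x (del (.u 0 0) b) := fun b => del_comm _ _ _
  have hφx : del .x (ofU f hf) = 0 := del_ofU_of_ne hf (by simp)
  have hφx' : del .x (del (.u 0 0) (ofU f hf)) = 0 := by rw [del_comm, hφx, map_zero]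
  -- The terms with `u_t` cancel. The linearization of `M` is self-adjoint, so the right-hand side
  -- is `k_u D_x M` minus this linearization applied to `D_x k`.
  rw [euler_eqn_mul hk.isLow hN, hk.dt_eq, hk (.u 0 1) (by simp), hk (.u 0 2) (by simp), eqn,
    dx_massFlux] at h
  simp only [map_add, Derivation.leibniz, Derivation.leibniz_pow, dx_X_u, hk.dx_eq,
    (hk.del _).dx_eq, ((hk.del _).del _).dx_eq, (hφ.del _).dx_eq,
    hxu, hφx', derivation_ofNat, smul_eq_mul, nsmul_eq_mul, mul_zero, add_zero] at h
  simp at h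
  linear_combination h

end DF
end QKdV
end

/-! ### Solution of the determining equation -/

noncomputable section
open Set Filter Topology
namespace QKdV
namespace DF

variable {R : JetVar → Set ℝ} [hR : Fact (IsJetBox R)] {f : ℝ → ℝ}

/-- The solution of the determining equation for `k(t, x, u)`. -/
theorem base_solution {hf : ContDiffOn ℝ ∞ f (R (.u 0 0))} {k c' : DF R}
    (hk : IsBase k) (hc' : ∀ c, c ≠ .t → del c c' = 0) {N : ℕ} (hN : 4 ≤ N)
    (h : dt k + c' * massFlux (ofU f hf) = euler 0 N (eqn hf * k)) :
    del (.u 0 0) (del (.u 0 0) k) = 0 ∧ del .x k = X (.u 0 0) * del .x (del (.u 0 0) k) ∧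
      c' = -5 * del .x (del (.u 0 0) k) ∧ (∀ c, del c c' = 0) ∧ del .x (del .t k) = 0 ∧
      5 * (c' * ofU f hf) + 5 * del .t k = c' * (X (.u 0 0) * del (.u 0 0) (ofU f hf)) := by
  have hE := base_determining_equation hk hN h
  have hb1 : ∀ {b : DF R}, IsBase b → del (.u 0 1) b = 0 := fun hb => hb _ (by simp)
  have hb2 : ∀ {b : DF R}, IsBase b → del (.u 0 2) b = 0 := fun hb => hb _ (by simp)
  have hφ := isBase_ofU hf
  -- This is the `u_xx`-coefficient with a factor `u` cancelled. Its `u_x`-derivative gives `k_uu =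
  -- 0`, and its `u`-derivative then gives `c' = -5 k_xu`.
  have h2 : c' * X (.u 0 0) = -3 * X (.u 0 0) * (del .x (del (.u 0 0) k) +
      X (.u 0 1) * del (.u 0 0) (del (.u 0 0) k)) - 2 * del .x k := by
    have := congrArg (del (.u 0 2)) hE
    simp [massFlux, Derivation.leibniz_pow, del_X, hc', hb2 hφ, hb2 (hφ.del _), hb2 (hk.del _),
      hb2 ((hk.del _).del _), hb2 (((hk.del _).del _).del _)] at this
    refine X_mul_cancel (.u 0 0) ?_
    linear_combination this
  have h00 : del (.u 0 0) (del (.u 0 0) k) = 0 := by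
    have := congrArg (del (.u 0 1)) h2
    simp [del_X, hc', hb1 (hk.del _), hb1 ((hk.del _).del _)] at this
    refine eq_zero_of_X_mul_eq_zero (c := .u 0 0) (ofNat_mul_cancel 3 ?_)
    linear_combination this
  have hx00 : del (.u 0 0) (del .x (del (.u 0 0) k)) = 0 := by rw [del_comm, h00, map_zero]
  have hc5 : c' = -5 * del .x (del (.u 0 0) k) := by
    rw [h00] at h2
    have := congrArg (del (.u 0 0)) h2
    simp [del_X, hc', hx00, del_comm (.u 0 0) .x] at this
    linear_combination this
  have hkx : del .x k = X (.u 0 0) * del .x (del (.u 0 0) k) := by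
    refine ofNat_mul_cancel 2 ?_
    rw [h00] at h2
    linear_combination h2 - X (.u 0 0) * hc5
  have hxx0 : del .x (del .x (del (.u 0 0) k)) = 0 := by
    have := congrArg (del .x) hc5
    simp [hc'] at this
    refine ofNat_mul_cancel 5 ?_
    linear_combination this
  have hxx : del .x (del .x k) = 0 := by
    rw [hkx]; simp [del_X, hxx0]
  -- The jet-free remainder `c' f + k_t = -f' k_x`, with `k_x` expressed through `c'`. Only `k_t`
  -- can depend on `x` here, hence `k_xt = 0` and `c'' = 0`.
  have hG : 5 * (c' * ofU f hf) + 5 * del .t k =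
      c' * (X (.u 0 0) * del (.u 0 0) (ofU f hf)) := by
    rw [hxx, hxx0, h00, hkx, map_zero, map_zero, massFlux] at hE
    rw [hc5] at hE ⊢
    linear_combination 5 * hE
  have hxt : del .x (del .t k) = 0 := by
    have hφx : del .x (ofU f hf) = 0 := del_ofU_of_ne hf (by simp)
    have hφx' : del .x (del (.u 0 0) (ofU f hf)) = 0 := by rw [del_comm, hφx, map_zero]
    have := congrArg (del .x) hG
    simp [del_X, hc', hφx, hφx'] at this
    refine ofNat_mul_cancel 5 ?_
    linear_combination this
  refine ⟨h00, hkx, hc5, fun c => ?_, hxt, hG⟩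
  by_cases hc : c = .t
  · subst hc
    rw [hc5]
    simp [del_comm .t .x, del_comm .t (.u 0 0), del_comm .x (.u 0 0), hxt]
  · exact hc' c hc

/-- Functions with `5 γ φ + w = γ u φ'`, where `w` is affine in `u`. -/
theorem special_of_equation {hf : ContDiffOn ℝ ∞ f (R (.u 0 0))} {γ : ℝ} (hγ : γ ≠ 0) {w : DF R}
    (hw : del (.u 0 0) (del (.u 0 0) w) = 0)
    (h : 5 * (γ • ofU f hf) + w = γ • (X (.u 0 0) * del (.u 0 0) (ofU f hf))) :
    ∃ f₀ f₁ f₂ : ℝ, ofU f hf = f₀ • X (.u 0 0) ^ 5 + f₁ • X (.u 0 0) + f₂ • 1 := by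
  have hφ : ∀ c, c ≠ .u 0 0 → del c (ofU f hf) = 0 := fun c hc => del_ofU_of_ne hf hc
  set φ := ofU f hf
  have hne : ∀ {b : DF R}, (∀ c, c ≠ .u 0 0 → del c b = 0) →
      ∀ c, c ≠ .u 0 0 → del c (del (.u 0 0) b) = 0 := fun hb c hc => by
    rw [del_comm, hb c hc, map_zero]
  have hconst : ∀ {b : DF R}, (∀ c, c ≠ .u 0 0 → del c b = 0) → del (.u 0 0) b = 0 →
      ∃ r : ℝ, b = r • (1 : DF R) := fun hb h0 => exists_eq_smul_one fun c => by
    by_cases hc : c = .u 0 0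
    · rw [hc, h0]
    · exact hb c hc
  set φ1 := del (.u 0 0) φ with hφ1
  set φ2 := del (.u 0 0) φ1 with hφ2
  set φ3 := del (.u 0 0) φ2 with hφ3
  set φ4 := del (.u 0 0) φ3 with hφ4
  set φ5 := del (.u 0 0) φ4 with hφ5
  -- Two differentiations remove `w`. Further ones show that the fifth derivative is a constant `κ`,
  -- and chaining the relations gives `6 φ'' = κ u³`.
  have e2 : 3 * φ2 = X (.u 0 0) * φ3 := by
    have := congrArg (fun b => del (.u 0 0) (del (.u 0 0) b)) h
    simp [del_X, hw, ← hφ1, ← hφ2, ← hφ3] at this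
    have h' : γ • (3 * φ2) = γ • (X (.u 0 0) * φ3) := by
      ext z hz
      have h'' := congrArg (fun b : DF R => b z) this
      simp only [add_apply, mul_apply, smul_apply, ofNat_apply _ hz] at h'' ⊢
      linear_combination h''
    exact (IsUnit.mk0 γ hγ).smul_left_cancel.1 h'
  have e3 : 2 * φ3 = X (.u 0 0) * φ4 := by
    have := congrArg (del (.u 0 0)) e2
    simp [del_X, ← hφ3, ← hφ4] at this
    linear_combination this
  have e4 : φ4 = X (.u 0 0) * φ5 := by
    have := congrArg (del (.u 0 0)) e3
    simp [del_X, ← hφ4, ← hφ5] at this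
    linear_combination this
  have e5 : del (.u 0 0) φ5 = 0 := by
    have := congrArg (del (.u 0 0)) e4
    simp [del_X, ← hφ5] at this
    exact eq_zero_of_X_mul_eq_zero this
  obtain ⟨κ, hκ⟩ := hconst (hne (hne (hne (hne (hne hφ))))) e5
  rw [← hφ1, ← hφ2, ← hφ3, ← hφ4, ← hφ5] at hκ
  have d2 : φ2 = (κ / 6) • X (.u 0 0) ^ 3 := by
    refine ofNat_mul_cancel 6 ?_
    have : (6 : DF R) * ((κ / 6) • X (.u 0 0) ^ 3) = X (.u 0 0) ^ 3 * (κ • 1) := by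
      ext z hz
      simp [ofNat_apply _ hz]
      ring
    rw [this, ← hκ]
    linear_combination 2 * e2 + X (.u 0 0) * e3 + X (.u 0 0) ^ 2 * e4
  have hXne : ∀ (n : ℕ) c, c ≠ .u 0 0 → del c (X (.u 0 0) ^ n : DF R) = 0 := fun n c hc => by
    simp [Derivation.leibniz_pow, del_X, hc]
  have d1 : del (.u 0 0) (φ1 - (κ / 24) • X (.u 0 0) ^ 4) = 0 := by
    rw [map_sub, ← hφ2, d2]
    ext z hz
    simp [Derivation.leibniz_pow, del_X, ofNat_apply _ hz, pow_apply _ _ hz]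
    ring
  obtain ⟨f₁, hf₁⟩ := hconst (fun c hc => by
    rw [map_sub, hne hφ c hc, Derivation.map_smul, hXne 4 c hc, smul_zero, sub_zero]) d1
  have d0 : del (.u 0 0) (φ - (κ / 120) • X (.u 0 0) ^ 5 - f₁ • X (.u 0 0)) = 0 := by
    rw [map_sub, map_sub, ← hφ1, eq_add_of_sub_eq hf₁]
    ext z hz
    simp [Derivation.leibniz_pow, del_X, ofNat_apply _ hz, pow_apply _ _ hz]
    ring
  obtain ⟨f₂, hf₂⟩ := hconst (fun c hc => by
    simp [hφ c hc, hXne 5 c hc, del_X, hc]) d0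
  exact ⟨κ / 120, f₁, f₂, by linear_combination hf₂⟩

/-- Classification of the low-order multipliers. -/
theorem classification {hf : ContDiffOn ℝ ∞ f (R (.u 0 0))} {q : DF R} (hq : IsLow q)
    (h : ∃ N₀, ∀ N, N₀ ≤ N → dt q = euler 0 N (eqn hf * q))
    (hM : ∃ N₀, ∀ N, N₀ ≤ N →
      dt (massFlux (ofU f hf)) = euler 0 N (eqn hf * massFlux (ofU f hf))) :
    ∃ γ : ℝ, del .t (del (.u 0 0) (del (.u 0 0) (del (.u 0 2) q))) = (2 * γ) • 1 ∧
      (γ = 0 → ∃ c₀ α β : ℝ, q = c₀ • massFlux (ofU f hf) + α • X (.u 0 0) + β • 1) ∧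
      (γ ≠ 0 → ∃ f₀ f₁ f₂ : ℝ,
        ofU f hf = f₀ • X (.u 0 0) ^ 5 + f₁ • X (.u 0 0) + f₂ • 1) := by
  obtain ⟨N₀, hN₀⟩ := h
  obtain ⟨N₁, hN₁⟩ := hM
  have h01 := multiplier_self_adjoint hq hN₀
  obtain ⟨h22, htop⟩ := multiplier_top_equation hq hN₀
  obtain ⟨ha, hc⟩ := leading_coefficient (hq.del _) h22 htop
  -- The factor `1/2` makes `q_{u_xx} = c u²`, and is the origin of `2 * γ` in the conclusion, where
  -- `γ = c'`.
  set c : DF R := (1 / 2 : ℝ) • del (.u 0 0) (del (.u 0 0) (del (.u 0 2) q)) with hcdef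
  have hc0 : ∀ d, d ≠ .t → del d c = 0 := fun d hd => by
    rw [hcdef, Derivation.map_smul, hc d hd, smul_zero]
  have hcu : ∀ i j, del (.u i j) c = 0 := fun i j => hc0 _ (by simp)
  have hdxc : dx c = 0 := by rw [dx_eq_of_del_u_eq_zero hcu, hc0 _ (by simp)]
  have hdtc : dt c = del .t c := dt_eq_of_del_u_eq_zero hcu
  set M := massFlux (ofU f hf) with hMdef
  have hφ := isBase_ofU hf
  -- Self-adjointness gives `q_{u_x} = D_x (c u²) = 2 c u u_x`, which is also the `u_x`-derivative
  -- of `c M`.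
  have hk : IsBase (q - c * M) := by
    intro d hd
    by_cases hlow : d ∈ lowCoords
    · simp only [lowCoords, Finset.mem_insert, Finset.mem_singleton] at hlow hd
      rcases hlow with rfl | rfl | rfl | rfl | rfl
      · simp at hd
      · simp at hd
      · simp at hd
      · rw [map_sub, h01, ha]
        simp [hMdef, massFlux, Derivation.leibniz_pow, del_X, hcu, hφ (.u 0 1), hdxc]
        ring
      · rw [map_sub, ha]
        simp [hMdef, massFlux, Derivation.leibniz_pow, del_X, hcu, hφ (.u 0 2)]
    · have h1 := hq d hlow
      simp only [lowCoords, Finset.mem_insert, Finset.mem_singleton, not_or] at hlow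
      simp [hMdef, massFlux, Derivation.leibniz_pow, del_X, hc0 d hlow.1, hφ d hd, h1, hlow]
  -- `c` passes through the Euler operator because it depends on `t` alone. As `M` solves the
  -- determining equation, the only defect is `c' M`.
  have hkeq : dt (q - c * M) + del .t c * M =
      euler 0 (max (max N₀ N₁) 4) (eqn hf * (q - c * M)) := by
    have h1 := hN₀ (max (max N₀ N₁) 4) (by omega)
    have h2 := hN₁ (max (max N₀ N₁) 4) (by omega)
    have h3 : eqn hf * (q - c * M) = eqn hf * q - c * (eqn hf * M) := by ring
    rw [h3, euler_sub, euler_mul 0 _ hdxc fun j => hcu 0 j, ← h1, ← h2, map_sub,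
      Derivation.leibniz, hdtc, smul_eq_mul, smul_eq_mul]
    ring
  obtain ⟨h00, hkx, hc5, hcc, hxt, hG⟩ := base_solution hk (fun d hd => by
    rw [del_comm, hc0 d hd, map_zero]) (by omega) hkeq
  obtain ⟨γ, hγ⟩ := exists_eq_smul_one hcc
  refine ⟨γ, ?_, fun h0 => ?_, fun h0 => ?_⟩
  · have : del .t c = (1 / 2 : ℝ) • del .t (del (.u 0 0) (del (.u 0 0) (del (.u 0 2) q))) := by
      rw [hcdef, Derivation.map_smul]
    rw [mul_smul, ← hγ, this, smul_smul]
    norm_num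
  · rw [h0, zero_smul] at hγ
    rw [hγ] at hG hc5
    have hkxu : del .x (del (.u 0 0) (q - c * M)) = 0 := by
      refine ofNat_mul_cancel 5 ?_
      linear_combination hc5
    have hkt : del .t (q - c * M) = 0 := by
      refine ofNat_mul_cancel 5 ?_
      linear_combination hG
    obtain ⟨c₀, hc₀⟩ := exists_eq_smul_one (a := c) fun d => by
      by_cases hd : d = .t
      · rw [hd, hγ]
      · exact hc0 d hd
    obtain ⟨α, hα⟩ := exists_eq_smul_one (a := del (.u 0 0) (q - c * M)) fun d => by
      by_cases hd : d ∈ ({.t, .x, .u 0 0} : Finset JetVar)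
      · simp only [Finset.mem_insert, Finset.mem_singleton] at hd
        rcases hd with rfl | rfl | rfl
        · rw [del_comm, hkt, map_zero]
        · exact hkxu
        · exact h00
      · exact (hk.del _) d hd
    obtain ⟨β, hβ⟩ := exists_eq_smul_one (a := q - c * M - α • X (.u 0 0)) fun d => by
      by_cases hd : d ∈ ({.t, .x, .u 0 0} : Finset JetVar)
      · simp only [Finset.mem_insert, Finset.mem_singleton] at hd
        rcases hd with rfl | rfl | rfl
        · rw [map_sub, hkt]; simp [del_X]
        · rw [map_sub, hkx, hkxu]; simp [del_X]
        · rw [map_sub, hα]; simp [del_X]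
      · rw [map_sub, hk d hd]
        simp only [Finset.mem_insert, Finset.mem_singleton, not_or] at hd
        simp [del_X, hd]
    refine ⟨c₀, α, β, ?_⟩
    have h1 : c₀ • M = c * M := by rw [hc₀, smul_mul_assoc, one_mul]
    rw [h1]
    linear_combination hβ
  · rw [hγ] at hG
    simp only [smul_mul_assoc, one_mul] at hG
    refine special_of_equation h0 (w := 5 * del .t (q - c * M)) ?_ hG
    simp [del_comm (.u 0 0) .t, h00, - map_sub]

end DF
end QKdV
end

/-! ### Bases of the space of low-order conservation laws -/

noncomputable section
open Set Filter Topology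
namespace QKdV
open DF

theorem contDiffOn_of_hasDerivAt {I : Set ℝ} (hI : IsOpen I) {φ ψ : ℝ → ℝ}
    (hψ : ContDiffOn ℝ ∞ ψ I) (h : ∀ v ∈ I, HasDerivAt φ (ψ v) v) : ContDiffOn ℝ ∞ φ I :=
  (contDiffOn_infty_iff_deriv_of_isOpen hI).2
    ⟨fun v hv => (h v hv).differentiableAt.differentiableWithinAt,
      hψ.congr fun v hv => (h v hv).deriv⟩

variable {R : JetVar → Set ℝ} {f F H : ℝ → ℝ}

theorem ofU_eq_of_isSpecial (hf : ContDiffOn ℝ ∞ f (R (.u 0 0))) {f₀ f₁ f₂ : ℝ} (h : IsSpecial (R (.u 0 0)) f f₀ f₁ f₂) :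
    ofU f hf = f₀ • X (.u 0 0) ^ 5 + f₁ • X (.u 0 0) + f₂ • 1 := by
  ext z hz
  simp [ofU_apply hf hz, h _ (hz (.u 0 0)), X_apply _ hz, pow_apply _ _ hz, one_apply hz]

theorem isDiffFunOf_massFlux (hf : ContDiffOn ℝ ∞ f (R (.u 0 0))) : IsDiffFunOf R lowCoords (massFlux (ofU f hf)) := by
  have h0 : IsDiffFunOf R lowCoords fun z => z (.u 0 0) := IsDiffFunOf.coord (by simp)
  have h1 : IsDiffFunOf R lowCoords fun z => z (.u 0 1) := IsDiffFunOf.coord (by simp)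
  have h2 : IsDiffFunOf R lowCoords fun z => z (.u 0 2) := IsDiffFunOf.coord (by simp)
  have h3 : IsDiffFunOf R lowCoords fun z => f (z (.u 0 0)) :=
    IsDiffFunOf.comp_coord (by simp) hf
  refine ((((h0.pow 2).mul h2).add (h0.mul (h1.pow 2))).add h3).congr fun z hz => ?_
  simp [massFlux, X_apply _ hz, ofU_apply hf hz, pow_apply _ _ hz]

theorem isDiffFunOf_one : IsDiffFunOf R lowCoords (1 : DF R) :=
  (IsDiffFunOf.const _ 1).congr fun _ hz => one_apply hz

theorem isDiffFunOf_X {c : JetVar} (hc : c ∈ lowCoords) : IsDiffFunOf R lowCoords (X c : DF R) :=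
  (IsDiffFunOf.coord hc).congr fun _ hz => X_apply c hz

theorem isDiffFunOf_extraMultiplier (f₀ f₁ : ℝ) :
    IsDiffFunOf R lowCoords (extraMultiplier f₀ f₁ : DF R) := by
  have ht : IsDiffFunOf R lowCoords fun z => z .t := IsDiffFunOf.coord (by simp)
  have hx : IsDiffFunOf R lowCoords fun z => z .x := IsDiffFunOf.coord (by simp)
  have h0 : IsDiffFunOf R lowCoords fun z => z (.u 0 0) := IsDiffFunOf.coord (by simp)
  have h1 : IsDiffFunOf R lowCoords fun z => z (.u 0 1) := IsDiffFunOf.coord (by simp)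
  have h2 : IsDiffFunOf R lowCoords fun z => z (.u 0 2) := IsDiffFunOf.coord (by simp)
  have hc : ∀ r : ℝ, IsDiffFunOf R lowCoords fun _ => r := IsDiffFunOf.const _
  refine (((((hc 2).mul (ht.mul (((h0.pow 2).mul h2).add (h0.mul (h1.pow 2))))).add
    ((hc (2 * f₀)).mul (ht.mul (h0.pow 5)))).add ((hc (2 / 5 * f₁)).mul (ht.mul h0))).sub
    ((hc (2 / 5)).mul (hx.mul h0))).congr fun z hz => ?_
  simp [extraMultiplier, X_apply _ hz, pow_apply _ _ hz]

variable [hR : Fact (IsJetBox R)]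

section
variable (hf : ContDiffOn ℝ ∞ f (R (.u 0 0)))
include hf

theorem hasDerivAt_of_smooth {v : ℝ} (hv : v ∈ R (.u 0 0)) : HasDerivAt f (deriv f v) v :=
  ((hf.contDiffAt ((hR.out.1 _).1.mem_nhds hv)).differentiableAt (by simp)).hasDerivAt

theorem contDiffOn_deriv : ContDiffOn ℝ ∞ (deriv f) (R (.u 0 0)) :=
  hf.deriv_of_isOpen (hR.out.1 _).1 (by simp)

theorem contDiffOn_momentumPotential
    (hH : ∀ v ∈ R (.u 0 0), HasDerivAt H (v * deriv f v) v) : ContDiffOn ℝ ∞ H (R (.u 0 0)) :=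
  contDiffOn_of_hasDerivAt (hR.out.1 _).1 (contDiffOn_id.mul (contDiffOn_deriv hf)) hH

theorem hasSpatialForm_mass : HasSpatialForm hf (massLaw f) 1 := by
  refine ⟨X (.u 0 0), massFlux (ofU f hf), fun z hz => ?_, fun z hz => ?_, fun K => pull_X_u K 0, ?_⟩
  · simp [massLaw, X_apply _ hz]
  · simp [massLaw, massFlux, X_apply _ hz, ofU_apply hf hz, pow_apply _ _ hz]
  · rw [dt_X_u, eqn, mul_one]

theorem hasSpatialForm_momentum (hH : ∀ v ∈ R (.u 0 0), HasDerivAt H (v * deriv f v) v) :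
    HasSpatialForm hf (momentumLaw H) (X (.u 0 0)) := by
  have hH' := contDiffOn_momentumPotential hf hH
  refine ⟨_, _, fun z hz => ?_, fun z hz => ?_, fun K => ?_,
    momentum_identity (φ := ofU f hf) (η := ofU H hH') (dx_ofU hf) ?_⟩
  · simp [momentumLaw, X_apply _ hz, pow_apply _ _ hz]
  · simp [momentumLaw, X_apply _ hz, pow_apply _ _ hz, ofU_apply hH' hz]
    ring
  · simp only [pull_smul, pull_pow, pull_X_u]
  · have h1 : del (.u 0 0) (ofU H hH') = X (.u 0 0) * del (.u 0 0) (ofU f hf) := by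
      rw [del_ofU hH' (contDiffOn_id.mul (contDiffOn_deriv hf)) hH,
        del_ofU hf (contDiffOn_deriv hf) fun v hv => hasDerivAt_of_smooth hf hv]
      ext z hz
      rw [mul_apply, ofU_apply _ hz, ofU_apply _ hz, X_apply _ hz]
      rfl
    rw [dx_ofU, h1]

theorem hasSpatialForm_energy (hF : ∀ v ∈ R (.u 0 0), HasDerivAt F (f v) v) :
    HasSpatialForm hf (energyLaw f F) (-massFlux (ofU f hf)) := by
  have hF' := contDiffOn_of_hasDerivAt (hR.out.1 _).1 hf hF
  refine ⟨_, _, fun z hz => ?_, fun z hz => ?_, fun K => ?_,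
    energy_identity (φ := ofU f hf) (Φ := ofU F hF') (dx_ofU hf) ?_⟩
  · simp [energyLaw, X_apply _ hz, pow_apply _ _ hz, ofU_apply hF' hz]
    ring
  · simp [energyLaw, X_apply _ hz, pow_apply _ _ hz, ofU_apply hf hz]
    ring
  · simp only [pull_sub, pull_smul, pull_mul, pull_pow, pull_X_u, pull_ofU]
  · rw [dt_of_del_eq_zero fun c hc => del_ofU_of_ne hF' hc, del_ofU hF' hf hF]

theorem isSpecial_of_ofU_eq {f₀ f₁ f₂ : ℝ}
    (h : ofU f hf = f₀ • X (.u 0 0) ^ 5 + f₁ • X (.u 0 0) + f₂ • 1) :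
    IsSpecial (R (.u 0 0)) f f₀ f₁ f₂ := by
  intro v hv
  obtain ⟨w, hw⟩ := jetBox_nonempty hR.out
  have hz := update_mem_jetBox hw hv
  have := congrArg (fun b : DF R => b (Function.update w (.u 0 0) v)) h
  simpa [ofU_apply hf hz, X_apply _ hz, pow_apply _ _ hz, one_apply hz] using this

theorem hasSpatialForm_extra {f₀ f₁ f₂ : ℝ} (h : IsSpecial (R (.u 0 0)) f f₀ f₁ f₂) :
    HasSpatialForm hf (extraLaw f₀ f₁) (extraMultiplier f₀ f₁) := by
  refine ⟨extraDensity f₀ f₁, extraFlux f₀ f₁, fun z hz => ?_, fun z hz => ?_, fun K => ?_, ?_⟩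
  · simp [extraLaw, extraDensity, X_apply _ hz, pow_apply _ _ hz]
    ring
  · simp [extraLaw, extraFlux, X_apply _ hz, pow_apply _ _ hz]
    ring
  · simp only [extraDensity, pull_add, pull_sub, pull_smul, pull_mul, pull_pow, pull_X_u, pull_X_t,
      pull_X_x]
  · rw [extra_identity f₀ f₁ f₂, eqn, ofU_eq_of_isSpecial hf h]

end

theorem isLow_of_isDiffFunOf {a : DF R} (h : IsDiffFunOf R lowCoords a) : IsLow a :=
  fun _ hc => del_eq_zero_of_isDiffFunOf h hc

namespace DF.IsLow

theorem smul (r : ℝ) {a : DF R} (ha : IsLow a) : IsLow (r • a) := fun c hc => by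
  rw [Derivation.map_smul, ha c hc, smul_zero]

theorem add {a b : DF R} (ha : IsLow a) (hb : IsLow b) : IsLow (a + b) := fun c hc => by
  rw [map_add, ha c hc, hb c hc, add_zero]

theorem neg {a : DF R} (ha : IsLow a) : IsLow (-a) := fun c hc => by
  rw [map_neg, ha c hc, neg_zero]

end DF.IsLow

theorem smul_one_eq_zero {r : ℝ} (h : r • (1 : DF R) = 0) : r = 0 := by
  refine algebraMap_injective (R := R) ?_
  rw [Algebra.algebraMap_eq_smul_one, h, map_zero]

/-- The multipliers of the four conservation laws. -/
def multiplier (hf : ContDiffOn ℝ ∞ f (R (.u 0 0))) (f₀ f₁ : ℝ) (c₀ c₁ c₂ c₃ : ℝ) : DF R :=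
  c₀ • 1 + c₁ • X (.u 0 0) + c₂ • -massFlux (ofU f hf) + c₃ • extraMultiplier f₀ f₁

theorem isLow_multiplier (hf : ContDiffOn ℝ ∞ f (R (.u 0 0))) (f₀ f₁ c₀ c₁ c₂ c₃ : ℝ) :
    IsLow (multiplier hf f₀ f₁ c₀ c₁ c₂ c₃) :=
  ((((isLow_of_isDiffFunOf isDiffFunOf_one).smul c₀).add
    ((isLow_of_isDiffFunOf (isDiffFunOf_X (by simp))).smul c₁)).add
    ((isLow_of_isDiffFunOf (isDiffFunOf_massFlux hf)).neg.smul c₂)).add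
    ((isLow_of_isDiffFunOf (isDiffFunOf_extraMultiplier f₀ f₁)).smul c₃)

/-- The `u_xx`-coefficient is `u² (2 c₃ t - c₂)`. It separates the last two multipliers by their
dependence on `t`, and `1` and `u` remain. -/
theorem multiplier_eq_zero {hf : ContDiffOn ℝ ∞ f (R (.u 0 0))} {f₀ f₁ c₀ c₁ c₂ c₃ : ℝ}
    (h : multiplier hf f₀ f₁ c₀ c₁ c₂ c₃ = 0) : c₀ = 0 ∧ c₁ = 0 ∧ c₂ = 0 ∧ c₃ = 0 := by
  have hφ : del (.u 0 2) (ofU f hf) = 0 := del_ofU_of_ne hf (by simp)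
  have h2 : X (.u 0 0) * (X (.u 0 0) * ((2 * c₃) • X .t - c₂ • (1 : DF R))) = 0 := by
    have := congrArg (del (.u 0 2)) h
    simp [multiplier, extraMultiplier, massFlux, Derivation.leibniz_pow, del_X, hφ] at this
    ext z hz
    have h' := congrArg (fun b : DF R => b z) this
    simp only [add_apply, sub_apply, mul_apply, smul_apply, neg_apply, zero_apply,
      pow_apply _ _ hz, one_apply hz] at h' ⊢
    linear_combination h'
  have h2' := eq_zero_of_X_mul_eq_zero (eq_zero_of_X_mul_eq_zero h2)
  have h3 : c₃ = 0 := by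
    have := congrArg (del .t) h2'
    simp only [map_sub, Derivation.map_smul, del_X, del_one, smul_zero, sub_zero, if_true,
      map_zero] at this
    linarith [smul_one_eq_zero this]
  have h4 : c₂ = 0 := by
    rw [h3] at h2'
    refine neg_eq_zero.1 (smul_one_eq_zero (R := R) ?_)
    simpa [neg_smul] using h2'
  rw [multiplier, h3, h4] at h
  have h5 : c₁ = 0 := by
    have := congrArg (del (.u 0 0)) h
    simp only [map_add, Derivation.map_smul, del_X, del_one, smul_zero, if_true, zero_smul, add_zero,
      zero_add, map_zero] at this
    exact smul_one_eq_zero this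
  rw [h5] at h
  exact ⟨smul_one_eq_zero (R := R) (by simpa using h), h5, h4, h3⟩

theorem multiplier_inj {hf : ContDiffOn ℝ ∞ f (R (.u 0 0))} {f₀ f₁ c₀ c₁ c₂ c₃ d₀ d₁ d₂ d₃ : ℝ}
    (h : multiplier hf f₀ f₁ c₀ c₁ c₂ c₃ = multiplier hf f₀ f₁ d₀ d₁ d₂ d₃) :
    c₀ = d₀ ∧ c₁ = d₁ ∧ c₂ = d₂ ∧ c₃ = d₃ := by
  have := multiplier_eq_zero (hf := hf) (f₀ := f₀) (f₁ := f₁) (c₀ := c₀ - d₀) (c₁ := c₁ - d₁)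
    (c₂ := c₂ - d₂) (c₃ := c₃ - d₃) (by
      rw [← sub_eq_zero.2 h]
      simp only [multiplier, sub_smul]
      ring)
  simpa only [sub_eq_zero] using this

theorem HasCharForm.sub_smul {hf : ContDiffOn ℝ ∞ f (R (.u 0 0))} {L L' : Pair} {q q' : DF R}
    (h : HasCharForm hf L q) (h' : HasCharForm hf L' q') (r : ℝ) :
    HasCharForm hf (L - r • L') (q - r • q') := by
  obtain ⟨T, Y, hT, hY, h⟩ := h
  obtain ⟨T', Y', hT', hY', h'⟩ := h'
  refine ⟨T - r • T', Y - r • Y', hT.sub (hT'.smul r), hY.sub (hY'.smul r), ?_⟩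
  rw [map_sub, map_sub, Derivation.map_smul, Derivation.map_smul, mul_sub, mul_smul_comm, ← h, ← h',
    smul_add]
  ring

section
variable (hf : ContDiffOn ℝ ∞ f (R (.u 0 0))) (hF : ∀ v ∈ R (.u 0 0), HasDerivAt F (f v) v)
  (hH : ∀ v ∈ R (.u 0 0), HasDerivAt H (v * deriv f v) v)
include hf hF

/-- The energy law supplies the fact that `M` solves the determining equation. In the case `γ = 0`
the values of `f₀`, `f₁` are arbitrary because the extra multiplier has coefficient zero. -/
theorem classification_of_hasCharForm {L : Pair} {q : DF R} (hL : HasCharForm hf L q)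
    (hq : IsLow q) :
    ∃ γ : ℝ, del .t (del (.u 0 0) (del (.u 0 0) (del (.u 0 2) q))) = (2 * γ) • 1 ∧
      (γ = 0 → ∃ c₀ c₁ c₂ : ℝ, ∀ f₀ f₁, q = multiplier hf f₀ f₁ c₀ c₁ c₂ 0) ∧
      (γ ≠ 0 → ∃ f₀ f₁ f₂ : ℝ, IsSpecial (R (.u 0 0)) f f₀ f₁ f₂) := by
  obtain ⟨γ, h1, h2, h3⟩ := classification hq (hL.dt_eq_euler fun i j => hq.del_u_succ i j) (by
    obtain ⟨N₀, hN⟩ := (hasSpatialForm_energy hf hF).hasCharForm.dt_eq_euler fun i j =>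
      (isLow_of_isDiffFunOf (isDiffFunOf_massFlux hf)).neg.del_u_succ i j
    refine ⟨N₀, fun N hN' => ?_⟩
    have h := hN N hN'
    have h1 : eqn hf * -massFlux (ofU f hf) = (-1 : ℝ) • (eqn hf * massFlux (ofU f hf)) := by
      rw [neg_smul, one_smul, mul_neg]
    rw [h1, euler_smul, map_neg, neg_smul, one_smul] at h
    exact neg_injective h)
  refine ⟨γ, h1, fun h0 => ?_, fun h0 => ?_⟩
  · obtain ⟨c₀, α, β, h⟩ := h2 h0
    refine ⟨β, α, -c₀, fun f₀ f₁ => ?_⟩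
    rw [h, multiplier, smul_neg, neg_smul, neg_neg, zero_smul]
    ring
  · obtain ⟨f₀, f₁, f₂, h⟩ := h3 h0
    exact ⟨f₀, f₁, f₂, isSpecial_of_ofU_eq hf h⟩

include hH

theorem hasSpatialForm_three (f₀ f₁ c₀ c₁ c₂ : ℝ) :
    HasSpatialForm hf (c₀ • massLaw f + c₁ • momentumLaw H + c₂ • energyLaw f F)
      (multiplier hf f₀ f₁ c₀ c₁ c₂ 0) := by
  rw [multiplier, zero_smul, add_zero]
  exact (((hasSpatialForm_mass hf).smul c₀).add ((hasSpatialForm_momentum hf hH).smul c₁)).add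
    ((hasSpatialForm_energy hf hF).smul c₂)

theorem hasSpatialForm_four {f₀ f₁ f₂ : ℝ} (h : IsSpecial (R (.u 0 0)) f f₀ f₁ f₂)
    (c₀ c₁ c₂ c₃ : ℝ) :
    HasSpatialForm hf
      (c₀ • massLaw f + c₁ • momentumLaw H + c₂ • energyLaw f F + c₃ • extraLaw f₀ f₁)
      (multiplier hf f₀ f₁ c₀ c₁ c₂ c₃) := by
  have := (hasSpatialForm_three hf hF hH f₀ f₁ c₀ c₁ c₂).add
    ((hasSpatialForm_extra hf h).smul c₃)
  rwa [multiplier, zero_smul, add_zero] at this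

theorem existsUnique_three
    (hns : ¬ ∃ f₀ f₁ f₂ : ℝ, IsSpecial (R (.u 0 0)) f f₀ f₁ f₂) {L : Pair}
    (hL : IsLowOrderLaw R f L) :
    ∃! c : Fin 3 → ℝ, EquivLaw R f L
      (c 0 • massLaw f + c 1 • momentumLaw H + c 2 • energyLaw f F) := by
  obtain ⟨L', q, hq, hqS, hsol⟩ := hL.exists_hasCharForm hf
  obtain ⟨γ, -, h0, h1⟩ := classification_of_hasCharForm hf hF hq (isLow_of_isDiffFunOf hqS)
  obtain ⟨c₀, c₁, c₂, hc⟩ := h0 (by_contra fun h => hns (h1 h))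
  have hE : EquivLaw R f L (c₀ • massLaw f + c₁ • momentumLaw H + c₂ • energyLaw f F) := by
    rw [hc 0 0] at hq
    exact hq.equivLaw (hasSpatialForm_three hf hF hH 0 0 c₀ c₁ c₂).hasCharForm hsol
  refine ⟨![c₀, c₁, c₂], hE, fun d hd => ?_⟩
  obtain ⟨e0, e1, e2, -⟩ := multiplier_inj
    ((hasSpatialForm_three hf hF hH 0 0 (d 0) (d 1) (d 2)).eq_of_equivLaw
    (hasSpatialForm_three hf hF hH 0 0 c₀ c₁ c₂)
    (fun i j => (isLow_multiplier hf _ _ _ _ _ _).del_u_succ i j)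
    (fun i j => (isLow_multiplier hf _ _ _ _ _ _).del_u_succ i j) hd hE)
  funext i
  fin_cases i
  exacts [e0, e1, e2]

/-- `γ` is linear in the multiplier and equals `2` for the extra law. Subtracting `γ / 2` times that
law therefore leaves a combination of the first three. -/
theorem existsUnique_four {f₀ f₁ f₂ : ℝ} (hs : IsSpecial (R (.u 0 0)) f f₀ f₁ f₂) {L : Pair}
    (hL : IsLowOrderLaw R f L) :
    ∃! c : Fin 4 → ℝ, EquivLaw R f L
      (c 0 • massLaw f + c 1 • momentumLaw H + c 2 • energyLaw f F + c 3 • extraLaw f₀ f₁) := by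
  obtain ⟨L', q, hq, hqS, hsol⟩ := hL.exists_hasCharForm hf
  have hlow := isLow_of_isDiffFunOf hqS
  have hlow' : IsLow (extraMultiplier f₀ f₁ : DF R) :=
    isLow_of_isDiffFunOf (isDiffFunOf_extraMultiplier f₀ f₁)
  obtain ⟨γ, hγ, -, -⟩ := classification_of_hasCharForm hf hF hq hlow
  obtain ⟨γ', hγ', h0, -⟩ := classification_of_hasCharForm hf hF
    (hq.sub_smul (hasSpatialForm_extra hf hs).hasCharForm (γ / 2)) (by
      rw [sub_eq_add_neg]
      exact hlow.add (hlow'.smul _).neg)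
  have hextra : del .t (del (.u 0 0) (del (.u 0 0) (del (.u 0 2) (extraMultiplier f₀ f₁ : DF R)))) =
      (4 : ℝ) • 1 := by
    ext z hz
    simp [extraMultiplier, Derivation.leibniz_pow, del_X, one_apply hz, ofNat_apply _ hz]
    norm_num
  have hγ0 : γ' = 0 := by
    rw [map_sub, map_sub, map_sub, map_sub, Derivation.map_smul, Derivation.map_smul,
      Derivation.map_smul, Derivation.map_smul, hγ, hextra, smul_smul, ← _root_.sub_smul] at hγ'
    have h1 : (2 * γ') • (1 : DF R) = 0 := by
      rw [← hγ']
      ring_nf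
      rw [zero_smul]
    linarith [smul_one_eq_zero h1]
  obtain ⟨c₀, c₁, c₂, hc⟩ := h0 hγ0
  have hqm : q = multiplier hf f₀ f₁ c₀ c₁ c₂ (γ / 2) := by
    have := hc f₀ f₁
    rw [multiplier, zero_smul, add_zero] at this
    rw [multiplier]
    linear_combination this
  have hE : EquivLaw R f L
      (c₀ • massLaw f + c₁ • momentumLaw H + c₂ • energyLaw f F + (γ / 2) • extraLaw f₀ f₁) := by
    rw [hqm] at hq
    exact hq.equivLaw (hasSpatialForm_four hf hF hH hs c₀ c₁ c₂ (γ / 2)).hasCharForm hsol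
  refine ⟨![c₀, c₁, c₂, γ / 2], hE, fun d hd => ?_⟩
  obtain ⟨e0, e1, e2, e3⟩ := multiplier_inj
    ((hasSpatialForm_four hf hF hH hs (d 0) (d 1) (d 2) (d 3)).eq_of_equivLaw
    (hasSpatialForm_four hf hF hH hs c₀ c₁ c₂ (γ / 2))
    (fun i j => (isLow_multiplier hf _ _ _ _ _ _).del_u_succ i j)
    (fun i j => (isLow_multiplier hf _ _ _ _ _ _).del_u_succ i j) hd hE)
  funext i
  fin_cases i
  exacts [e0, e1, e2, e3]

/-- An equivalence would equate two multipliers whose coefficients of the extra one are `1` and `0`.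
-/
theorem extraLaw_not_equivLaw {f₀ f₁ f₂ : ℝ} (hs : IsSpecial (R (.u 0 0)) f f₀ f₁ f₂)
    (c₀ c₁ c₂ : ℝ) : ¬ EquivLaw R f (extraLaw f₀ f₁)
      (c₀ • massLaw f + c₁ • momentumLaw H + c₂ • energyLaw f F) := by
  intro h
  have h4 := hasSpatialForm_four hf hF hH hs 0 0 0 1
  simp only [zero_smul, one_smul, zero_add] at h4
  have hrefl : EquivLaw R f (extraLaw f₀ f₁) (extraLaw f₀ f₁) :=
    h4.hasCharForm.equivLaw h4.hasCharForm fun _ _ => ⟨rfl, rfl⟩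
  have := multiplier_inj (h4.eq_of_equivLaw (hasSpatialForm_three hf hF hH f₀ f₁ c₀ c₁ c₂)
    (fun i j => (isLow_multiplier hf _ _ _ _ _ _).del_u_succ i j)
    (fun i j => (isLow_multiplier hf _ _ _ _ _ _).del_u_succ i j) hrefl h)
  exact one_ne_zero this.2.2.2

end

theorem coefficients_ne_zero (hf' : ∃ v ∈ R (.u 0 0), deriv f v ≠ 0) {f₀ f₁ f₂ : ℝ}
    (hs : IsSpecial (R (.u 0 0)) f f₀ f₁ f₂) : (f₀, f₁) ≠ (0, 0) := by
  intro h
  obtain ⟨rfl, rfl⟩ := Prod.mk.inj h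
  obtain ⟨v, hv, hne⟩ := hf'
  refine hne ?_
  have : f =ᶠ[𝓝 v] fun _ => f₂ := by
    filter_upwards [(hR.out.1 _).1.mem_nhds hv] with w hw
    simpa using hs w hw
  rw [this.deriv_eq, deriv_const]

end QKdV

end

/-! ### The main theorem -/

theorem theorem2 (R : JetVar → Set ℝ) (hR : QKdV.IsJetBox R)
    (f F H : ℝ → ℝ)
    (hf : ContDiffOn ℝ ∞ f (R (JetVar.u 0 0)))
    (hf' : ∃ v ∈ R (JetVar.u 0 0), deriv f v ≠ 0)
    (hF : ∀ v ∈ R (JetVar.u 0 0), HasDerivAt F (f v) v)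
    (hH : ∀ v ∈ R (JetVar.u 0 0), HasDerivAt H (v * deriv f v) v) :
    -- (i) mass, momentum and energy are low-order laws for every `f`,
    (QKdV.IsLowOrderLaw R f (QKdV.massLaw f) ∧
      QKdV.IsLowOrderLaw R f (QKdV.momentumLaw H) ∧
      QKdV.IsLowOrderLaw R f (QKdV.energyLaw f F)) ∧
    -- and, outside the family in (ii), they are a basis of all low-order laws up to equivalence
    ((¬ ∃ f₀ f₁ f₂ : ℝ, QKdV.IsSpecial (R (JetVar.u 0 0)) f f₀ f₁ f₂) →
      ∀ L : QKdV.Pair, QKdV.IsLowOrderLaw R f L →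
        ∃! c : Fin 3 → ℝ, QKdV.EquivLaw R f L
          (c 0 • QKdV.massLaw f + c 1 • QKdV.momentumLaw H + c 2 • QKdV.energyLaw f F)) ∧
    -- (ii) an additional low-order law exists exactly for the family `f₀ u⁵ + f₁ u + f₂`,
    ((∃ L : QKdV.Pair, QKdV.IsLowOrderLaw R f L ∧
        ∀ c : Fin 3 → ℝ, ¬ QKdV.EquivLaw R f L
          (c 0 • QKdV.massLaw f + c 1 • QKdV.momentumLaw H + c 2 • QKdV.energyLaw f F)) ↔
      ∃ f₀ f₁ f₂ : ℝ, (f₀, f₁) ≠ (0, 0) ∧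
        QKdV.IsSpecial (R (JetVar.u 0 0)) f f₀ f₁ f₂) ∧
    -- and then it is the stated one: together with the first three it is a basis
    (∀ f₀ f₁ f₂ : ℝ, QKdV.IsSpecial (R (JetVar.u 0 0)) f f₀ f₁ f₂ →
      QKdV.IsLowOrderLaw R f (QKdV.extraLaw f₀ f₁) ∧
      ∀ L : QKdV.Pair, QKdV.IsLowOrderLaw R f L →
        ∃! c : Fin 4 → ℝ, QKdV.EquivLaw R f L
          (c 0 • QKdV.massLaw f + c 1 • QKdV.momentumLaw H + c 2 • QKdV.energyLaw f F
            + c 3 • QKdV.extraLaw f₀ f₁)) := by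
  have : Fact (QKdV.IsJetBox R) := ⟨hR⟩
  refine ⟨⟨?_, ?_, ?_⟩, fun hns L hL => QKdV.existsUnique_three hf hF hH hns hL, ⟨?_, ?_⟩, ?_⟩
  · exact (QKdV.hasSpatialForm_mass hf).hasCharForm.isLowOrderLaw QKdV.isDiffFunOf_one
  · exact (QKdV.hasSpatialForm_momentum hf hH).hasCharForm.isLowOrderLaw
      (QKdV.isDiffFunOf_X (by simp))
  · refine (QKdV.hasSpatialForm_energy hf hF).hasCharForm.isLowOrderLaw ?_
    exact (QKdV.isDiffFunOf_massFlux hf).neg.congr fun z _ => QKdV.DF.neg_apply _ z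
  · rintro ⟨L, hL, hne⟩
    by_contra hns
    -- The condition `(f₀, f₁) ≠ (0, 0)` comes for free, since otherwise `f` would be constant on
    -- the interval.
    have hns' : ¬ ∃ f₀ f₁ f₂ : ℝ, QKdV.IsSpecial (R (JetVar.u 0 0)) f f₀ f₁ f₂ := by
      rintro ⟨f₀, f₁, f₂, hs⟩
      exact hns ⟨f₀, f₁, f₂, QKdV.coefficients_ne_zero hf' hs, hs⟩
    obtain ⟨c, hc, -⟩ := QKdV.existsUnique_three hf hF hH hns' hL
    exact hne c hc
  · rintro ⟨f₀, f₁, f₂, -, hs⟩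
    exact ⟨QKdV.extraLaw f₀ f₁, (QKdV.hasSpatialForm_extra hf hs).hasCharForm.isLowOrderLaw
      (QKdV.isDiffFunOf_extraMultiplier f₀ f₁),
      fun c => QKdV.extraLaw_not_equivLaw hf hF hH hs (c 0) (c 1) (c 2)⟩
  · intro f₀ f₁ f₂ hs
    exact ⟨(QKdV.hasSpatialForm_extra hf hs).hasCharForm.isLowOrderLaw
      (QKdV.isDiffFunOf_extraMultiplier f₀ f₁), fun L hL => QKdV.existsUnique_four hf hF hH hs hL⟩
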